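/- Let $n\ge 0$ be an integer and write $[a,b]=\{a,a+1,\dots,b\}$ (empty if $a>b$), $[n]=[1,n]$, $[n]_\pm=[n]\cup\{-1,\dots,-n\}$. Let $\mathcal D_n$ be the group of bijections $\sigma$ of $[n]_\pm$ with $\sigma(-i)=-\sigma(i)$ for all $i$ and with an even number of negative entries among $\sigma(1),\dots,\sigma(n)$. It acts linearly on $\mathbb Z^n$ by $\sigma(e_i)=e_{\sigma(i)}$, where $e_{-i}=-e_i$, preserving the root system $\Phi=\{\pm(e_i\pm e_j): 1\le i<j\le n\}$ of type $D_n$. Take the simple roots $e_1+e_2$ and $e_{i+1}-e_i$ for $i\in[n-1]$. Let $\Phi^+$ be the set of roots that are nonnegative combinations of simple roots, let $\Phi^-=-\Phi^+$, and let the height $\mathrm{ht}(\alpha)$ be the sum of the coefficients of $\alpha$ in the simple roots. For $\sigma\in\mathcal D_n$ set $$\ell(\sigma)=|\{\alpha\in\Phi^+:\sigma(\alpha)\in\Phi^-\}|,\qquad L(\sigma)=|\{\alpha\in\Phi^+:\mathrm{ht}(\alpha)\text{ odd},\ \sigma(\alpha)\in\Phi^-\}|.$$ For $i\in[n-1]$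 let $s_i=(i,i+1)(-i,-(i+1))$. For $I\subseteq[n-1]$ put $\mathcal D_n^I=\{\sigma\in\mathcal D_n:\ell(\sigma s_i)>\ell(\sigma)\text{ for all }i\in I\}$ and $$\mathcal D_n^I(x)=\sum_{\sigma\in\mathcal D_n^I}(-1)^{\ell(\sigma)}x^{L(\sigma)}.$$ Let $I_1,\dots,I_s$ be the connected components of $I$ (the maximal nonempty intervals of integers contained in $I$) and put $$m_I=\sum_{k=1}^s\left\lfloor\frac{|I_k|+1}{2}\right\rfloor,\qquad C_I=\frac{[m_I]_q!}{\prod_{k=1}^s\left[\left\lfloor\frac{|I_k|+1}{2}\right\rfloor\right]_q!}\Bigg|_{q=x^2},\qquad [m]_q!=\prod_{i=1}^m\frac{1-q^i}{1-q}.$$ **Proposition.** For every $I\subseteq[n-1]$, $$\mathcal D_n^I(x)=C_I\prod_{i=2}^n\left(1+(-1)^{i-1}x^{\lfloor i/2\rfloor}\right)\prod_{i=2m_I+2}^n\left(1+(-1)^{i-1}x^{\lfloor i/2\rfloor}\right),$$ where a product whose lower limit exceeds its upper limit equals $1$. -/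

import Mathlib

namespace OddLengthD

/-! ### Signed permutations and the even hyperoctahedral group -/

/-- The set `[n]_± = {-n, …, -1, 1, …, n}`. -/
abbrev PM (n : ℕ) : Type := ↥((Finset.Icc (-(n : ℤ)) (n : ℤ)).erase 0)

/-- The involution `i ↦ -i` of `[n]_±`. -/
def PM.neg {n : ℕ} (i : PM n) : PM n :=
  ⟨-(i : ℤ), by
    have h := i.2
    simp only [Finset.mem_erase, Finset.mem_Icc] at h ⊢
    omega⟩

/-- The element `k + 1` of `[n] ⊆ [n]_±`, for `k = 0, …, n - 1`. -/
def PM.pos {n : ℕ} (k : Fin n) : PM n :=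
  ⟨(k : ℤ) + 1, by
    have h := k.2
    simp only [Finset.mem_erase, Finset.mem_Icc]
    omega⟩

/-- `w` is a signed permutation of degree `n`: `w(-i) = -w(i)`. -/
def IsSigned {n : ℕ} (w : Equiv.Perm (PM n)) : Prop :=
  ∀ i : PM n, w i.neg = (w i).neg

noncomputable instance {n : ℕ} : DecidablePred (@IsSigned n) := fun w =>
  inferInstanceAs (Decidable (∀ i : PM n, w i.neg = (w i).neg))

/-- The even hyperoctahedral group: the signed permutations of degree `n` with an even number of
negative entries among `w(1), …, w(n)`. -/
noncomputable def evenHyperoctahedral (n : ℕ) : Finset (Equiv.Perm (PM n)) :=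
  Finset.univ.filter fun w =>
    IsSigned w ∧ Even (Finset.univ.filter fun k : Fin n => ((w (PM.pos k) : PM n) : ℤ) < 0).card

/-- The transposition `(a, b)` of `[n]_±` (the identity if `a` or `b` is not in `[n]_±`). -/
noncomputable def transp (n : ℕ) (a b : ℤ) : Equiv.Perm (PM n) :=
  if h : a ∈ (Finset.Icc (-(n : ℤ)) (n : ℤ)).erase 0 ∧ b ∈ (Finset.Icc (-(n : ℤ)) (n : ℤ)).erase 0
  then Equiv.swap ⟨a, h.1⟩ ⟨b, h.2⟩ else 1

/-- The Coxeter generators, indexed by `0, …, n - 1`: `s_0 = (1, -2)(2, -1)` and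
`s_i = (i, i+1)(-i, -(i+1))` for `1 ≤ i ≤ n - 1`. -/
noncomputable def simpleReflection (n i : ℕ) : Equiv.Perm (PM n) :=
  if i = 0 then transp n 1 (-2) * transp n 2 (-1)
  else transp n i (i + 1) * transp n (-i) (-(i + 1))

/-! ### The root system of type `D_n`, inside `ℤ^n` -/

/-- The vectors `e_a`: for `1 ≤ a ≤ n` the standard basis vector, and `e_{-a} = -e_a`. -/
def e (n : ℕ) (a : ℤ) : Fin n → ℤ := fun j =>
  if a = (j : ℤ) + 1 then 1 else if a = -((j : ℤ) + 1) then -1 else 0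

/-- The root system `Φ = {±(e_i ± e_j) : 1 ≤ i < j ≤ n}`. -/
def roots (n : ℕ) : Set (Fin n → ℤ) :=
  {α | ∃ i j : ℕ, 1 ≤ i ∧ i < j ∧ j ≤ n ∧
    (α = e n i + e n j ∨ α = -(e n i + e n j) ∨ α = e n i - e n j ∨ α = -(e n i - e n j))}

/-- The simple roots `e_1 + e_2` (index `0`) and `e_{i+1} - e_i` (index `1 ≤ i ≤ n - 1`). -/
def simpleRoot (n : ℕ) (i : Fin n) : Fin n → ℤ :=
  if (i : ℕ) = 0 then e n 1 + e n 2 else e n ((i : ℤ) + 1) - e n (i : ℤ)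

/-- The positive roots: the roots that are nonnegative combinations of simple roots. -/
def posRoots (n : ℕ) : Set (Fin n → ℤ) :=
  {α | α ∈ roots n ∧ ∃ c : Fin n → ℤ, (∀ i, 0 ≤ c i) ∧ α = ∑ i, c i • simpleRoot n i}

/-- The negative roots `Φ⁻ = -Φ⁺`. -/
def negRoots (n : ℕ) : Set (Fin n → ℤ) := {α | -α ∈ posRoots n}

/-- `α` has height `h`: `α = ∑ c_β β` over the simple roots, with `h = ∑ c_β`. -/
def HasHeight (n : ℕ) (α : Fin n → ℤ) (h : ℤ) : Prop :=
  ∃ c : Fin n → ℤ, α = ∑ i, c i • simpleRoot n i ∧ h = ∑ i, c i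

/-- The linear action of a signed permutation on `ℤ^n`, determined by `w(e_i) = e_{w(i)}`. -/
def act {n : ℕ} (w : Equiv.Perm (PM n)) (v : Fin n → ℤ) : Fin n → ℤ :=
  ∑ k : Fin n, v k • e n ((w (PM.pos k) : PM n) : ℤ)

/-- The Coxeter length: the number of positive roots sent to negative roots. -/
noncomputable def len {n : ℕ} (w : Equiv.Perm (PM n)) : ℕ :=
  {α | α ∈ posRoots n ∧ act w α ∈ negRoots n}.ncard

/-- The odd length: the number of positive roots of odd height sent to negative roots. -/
noncomputable def oddLen {n : ℕ} (w : Equiv.Perm (PM n)) : ℕ :=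
  {α | α ∈ posRoots n ∧ (∃ h, HasHeight n α h ∧ Odd h) ∧ act w α ∈ negRoots n}.ncard

/-- The parabolic quotient `{w | ℓ(w s_i) > ℓ(w) for all i ∈ I}`, for `I ⊆ [0, n-1]`. -/
noncomputable def quotient (n : ℕ) (I : Finset ℕ) : Finset (Equiv.Perm (PM n)) :=
  (evenHyperoctahedral n).filter fun w => ∀ i ∈ I, len w < len (w * simpleReflection n i)

/-- The sign-twisted generating function of the odd length over the parabolic quotient. -/
noncomputable def genFun (n : ℕ) (I : Finset ℕ) : Polynomial ℤ :=
  ∑ w ∈ quotient n I, (-1) ^ len w * Polynomial.X ^ oddLen w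

/-! ### Connected components and `q`-multinomial coefficients -/

/-- The endpoints `(a, b)` of the nonempty connected components `[a, b]` of `I`, that is, of the
maximal intervals contained in `I`. -/
def components (I : Finset ℕ) : Finset (ℕ × ℕ) :=
  (I ×ˢ I).filter fun p =>
    p.1 ≤ p.2 ∧ Finset.Icc p.1 p.2 ⊆ I ∧ (∀ c ∈ I, c + 1 ≠ p.1) ∧ p.2 + 1 ∉ I

/-- `⌊(|J| + 1) / 2⌋` for the interval `J = [a, b]`. -/
def halfSize (p : ℕ × ℕ) : ℕ := ((Finset.Icc p.1 p.2).card + 1) / 2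

/-- `m_I`; an empty component would contribute `0`. -/
def mI (I : Finset ℕ) : ℕ := ∑ p ∈ components I, halfSize p

/-- `[k]_q = (1 - q^k) / (1 - q)`. -/
def qNum {K : Type*} [Field K] (q : K) (k : ℕ) : K := (1 - q ^ k) / (1 - q)

/-- `[k]_q! = [1]_q [2]_q ⋯ [k]_q`. -/
def qFactorial {K : Type*} [Field K] (q : K) (k : ℕ) : K := ∏ i ∈ Finset.Icc 1 k, qNum q i

/-- `C_I`, the `q`-multinomial coefficient of `m_I` with parts `⌊(|I_k| + 1) / 2⌋` at `q = x²`, in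
the field of fractions of `ℤ[x]`; an empty component would contribute the factor `[0]_q! = 1`. -/
noncomputable def CI (I : Finset ℕ) : RatFunc ℤ :=
  qFactorial ((RatFunc.X : RatFunc ℤ) ^ 2) (mI I) /
    ∏ p ∈ components I, qFactorial ((RatFunc.X : RatFunc ℤ) ^ 2) (halfSize p)

end OddLengthD

/-! In one-line notation an element of the group is `u ∘ v`, with `u` the increasing arrangement of
its entries and `v` a permutation of the positions. For positions `a < b`, the positive root `e_b -
e_a` becomes negative exactly at an inversion, and `e_b + e_a` exactly when the two entries have
negative sum; both heights have the parity of `a + b`. So ℓ is the number of inversions plus the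
number of pairs with negative sum, and L counts the same over positions of opposite parity
(`len_eq`, `oddLen_eq`). Membership in the quotient says that `v` increases across `I`.

If the values `i` and `i + 1` of `v` sit in positions of equal parity, exchanging them flips the
sign but changes neither L nor the ascents at `I`. A sign-reversing involution therefore leaves only
the chessboard permutations, where consecutive values alternate in position parity
(`sum_eq_sum_chessboard`). These preserve or reverse the parity of all positions, so the pairs with
negative sum depend on `u` alone, and the generating function factors (`sum_quotient`).

The factor from `u` comes from adding the entry of largest absolute value: with a plus sign it
creates no pair of negative sum, with a minus sign it forms one with every other entry. This gives
the first product (`signTotal_eq`).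

The factor from `v` is the type A generating function `fullTotal`. Cut the positions into the
maximal blocks along which `I` forces an increase, and append the last block to a chessboard `v`. If
`d₁ ≥ d₂ ≥ …` count the earlier values above its successive entries, an entry contributes `(-1)^d`
times `x` to the number of the `d` largest values in positions of opposite parity. That number is `d
/ 2` rounded down or up, alternately along the block; which comes first depends only on the parity
of the position of the value `0`. Hence the pair (`evenTotal`, `fullTotal`) obeys a linear recursion
(`evenTotal_block`, `fullTotal_block`) whose coefficients are the sums `chainSum`. These have closed
forms in Gaussian binomials at `q = x²` (`chainSum_even`, `chainSum_odd`), and induction over the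
blocks (`totalSpec`) makes them telescope to the multinomial coefficient times the second product
(`fullTotal_eq`). -/

namespace OddLengthD

/-! ### Closed forms for alternating sums over weakly decreasing sequences -/

section ClosedForms

variable {K : Type*} [Field K]

/-- The signed sum over weakly decreasing sequences `D ≥ d₁ ≥ … ≥ d_q ≥ 0` of the weights
`(-1)^{Σ dᵢ} x^{⌊(d₁ + s) / 2⌋ + ⌊(d₂ + 1 - s) / 2⌋ + ⌊(d₃ + s) / 2⌋ + ⋯}`. -/
def chainSum (x : K) : ℕ → ℕ → ℕ → K
  | _, 0, _ => 1
  | s, q + 1, D =>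
    ∑ d ∈ Finset.range (D + 1), (-1) ^ d * x ^ ((d + s) / 2) * chainSum x (1 - s) q d

theorem chainSum_succ_zero (x : K) (s q : ℕ) (hs : s ≤ 1) :
    chainSum x s (q + 1) 0 = chainSum x (1 - s) q 0 := by
  have : s / 2 = 0 := by omega
  simp [chainSum, this]

theorem chainSum_succ_succ (x : K) (s q D : ℕ) :
    chainSum x s (q + 1) (D + 1) = chainSum x s (q + 1) D +
      (-1) ^ (D + 1) * x ^ ((D + 1 + s) / 2) * chainSum x (1 - s) q (D + 1) := by
  simp only [chainSum]
  rw [Finset.sum_range_succ]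

/-- `(q; q)_r` at `q = x²`. -/
def qPoch (x : K) (r : ℕ) : K := ∏ i ∈ Finset.Icc 1 r, (1 - x ^ (2 * i))

theorem qPoch_zero (x : K) : qPoch x 0 = 1 := by simp [qPoch]

theorem qPoch_succ (x : K) (r : ℕ) :
    qPoch x (r + 1) = qPoch x r * (1 - x ^ (2 * (r + 1))) := by
  simp only [qPoch]
  rw [Finset.prod_Icc_succ_top (by omega)]

/-- The Gaussian binomial coefficient of `e + k` over `k` at `q = x²`. -/
def gaussBinom (x : K) (e k : ℕ) : K := qPoch x (e + k) / (qPoch x e * qPoch x k)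

variable {x : K} (hm : ∀ i : ℕ, 1 - x ^ (i + 1) ≠ 0) (hp : ∀ i : ℕ, 1 + x ^ i ≠ 0)

include hm in
theorem qPoch_ne_zero (r : ℕ) : qPoch x r ≠ 0 := by
  induction r with
  | zero => simp [qPoch]
  | succ r ih =>
    rw [qPoch_succ]
    exact mul_ne_zero ih (hm (2 * r + 1))

include hm in
theorem gaussBinom_zero_left (k : ℕ) : gaussBinom x 0 k = 1 := by
  have := qPoch_ne_zero hm k
  simp [gaussBinom, qPoch_zero, this]

include hm in
theorem gaussBinom_zero_right (k : ℕ) : gaussBinom x k 0 = 1 := by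
  have := qPoch_ne_zero hm k
  simp [gaussBinom, qPoch_zero, this]

include hm in
theorem gaussBinom_succ_left (e k : ℕ) :
    gaussBinom x (e + 1) k =
      gaussBinom x e k * (1 - x ^ (2 * (e + k + 1))) / (1 - x ^ (2 * (e + 1))) := by
  have h1 := qPoch_ne_zero hm e
  have h2 := qPoch_ne_zero hm k
  have h3 : 1 - x ^ (2 * (e + 1)) ≠ 0 := hm (2 * e + 1)
  rw [gaussBinom, gaussBinom, show e + 1 + k = e + k + 1 by ring, qPoch_succ, qPoch_succ]
  field_simp

include hm in
theorem gaussBinom_succ_right (e k : ℕ) :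
    gaussBinom x e (k + 1) =
      gaussBinom x e k * (1 - x ^ (2 * (e + k + 1))) / (1 - x ^ (2 * (k + 1))) := by
  have h1 := qPoch_ne_zero hm e
  have h2 := qPoch_ne_zero hm k
  have h3 : 1 - x ^ (2 * (k + 1)) ≠ 0 := hm (2 * k + 1)
  rw [gaussBinom, gaussBinom, show e + (k + 1) = e + k + 1 by ring, qPoch_succ, qPoch_succ]
  field_simp

include hm hp in
/-- If `chainSum x 0 (2k)` has its closed form then so do both sums for `2k + 1`. -/
theorem chainSum_odd_of_even (k : ℕ)
    (hA : ∀ e, chainSum x 1 (2 * k) (2 * e) = gaussBinom x e k)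
    (hA' : ∀ e, chainSum x 1 (2 * k) (2 * e + 1) = gaussBinom x e k)
    (hB : ∀ e, chainSum x 0 (2 * k) (2 * e) =
      gaussBinom x e k * (x ^ e + x ^ k) / (1 + x ^ (e + k)))
    (hB' : ∀ e, chainSum x 0 (2 * k) (2 * e + 1) = x ^ k * gaussBinom x e k) (e : ℕ) :
    (chainSum x 1 (2 * k + 1) (2 * e) = gaussBinom x e k ∧
      chainSum x 1 (2 * k + 1) (2 * e + 1) = (1 - x ^ (e + k + 1)) * gaussBinom x e k) ∧
    (chainSum x 0 (2 * k + 1) (2 * e) = x ^ e * gaussBinom x e k ∧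
      chainSum x 0 (2 * k + 1) (2 * e + 1) = 0) := by
  have stepA : ∀ e, chainSum x 1 (2 * k + 1) (2 * e) = gaussBinom x e k →
      chainSum x 1 (2 * k + 1) (2 * e + 1) = (1 - x ^ (e + k + 1)) * gaussBinom x e k := by
    intro e h
    rw [chainSum_succ_succ, h, show 1 - 1 = 0 from rfl, hB',
      show (2 * e + 1 + 1) / 2 = e + 1 by omega, Odd.neg_one_pow ⟨e, rfl⟩]
    ring
  have stepB : ∀ e, chainSum x 0 (2 * k + 1) (2 * e) = x ^ e * gaussBinom x e k →
      chainSum x 0 (2 * k + 1) (2 * e + 1) = 0 := by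
    intro e h
    rw [chainSum_succ_succ, h, show 1 - 0 = 1 from rfl, hA',
      show (2 * e + 1 + 0) / 2 = e by omega, Odd.neg_one_pow ⟨e, rfl⟩]
    ring
  suffices h : chainSum x 1 (2 * k + 1) (2 * e) = gaussBinom x e k ∧
      chainSum x 0 (2 * k + 1) (2 * e) = x ^ e * gaussBinom x e k from
    ⟨⟨h.1, stepA e h.1⟩, h.2, stepB e h.2⟩
  induction e with
  | zero =>
    have h0 := hB 0
    have h1 := hA 0
    rw [mul_zero] at h0 h1
    constructor
    · rw [mul_zero, chainSum_succ_zero _ _ _ le_rfl, show 1 - 1 = 0 from rfl, h0]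
      have := hp k
      simp only [pow_zero, zero_add]
      field_simp
    · rw [mul_zero, chainSum_succ_zero _ _ _ (by omega), show 1 - 0 = 1 from rfl, h1]
      ring
  | succ e ih =>
    have hpos : ((-1 : K)) ^ (2 * e + 1 + 1) = 1 := Even.neg_one_pow ⟨e + 1, by ring⟩
    have n1 : 1 - x ^ (2 * (e + 1)) ≠ 0 := hm (2 * e + 1)
    constructor
    · rw [show 2 * (e + 1) = 2 * e + 1 + 1 by ring, chainSum_succ_succ, stepA e ih.1,
        show 1 - 1 = 0 from rfl, show 2 * e + 1 + 1 = 2 * (e + 1) by ring, hB,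
        show (2 * (e + 1) + 1) / 2 = e + 1 by omega,
        show 2 * (e + 1) = 2 * e + 1 + 1 by ring, hpos, gaussBinom_succ_left hm]
      have n2 := hp (e + 1 + k)
      field_simp
      ring
    · rw [show 2 * (e + 1) = 2 * e + 1 + 1 by ring, chainSum_succ_succ, stepB e ih.2,
        show 1 - 0 = 1 from rfl, show 2 * e + 1 + 1 = 2 * (e + 1) by ring, hA,
        show 2 * (e + 1) / 2 = e + 1 by omega,
        show 2 * (e + 1) = 2 * e + 1 + 1 by ring, hpos]
      ring

-- Induction on the bound: raising it by one adds a single term, whose tail has length `2 * k + 1`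
-- and the opposite `s`. The sums for `s = 0` and `s = 1` thus feed each other and are evaluated
-- together.
include hm hp in
theorem chainSum_even_of_odd (k : ℕ)
    (hA : ∀ e, chainSum x 1 (2 * k + 1) (2 * e) = gaussBinom x e k)
    (hA' : ∀ e, chainSum x 1 (2 * k + 1) (2 * e + 1) = (1 - x ^ (e + k + 1)) * gaussBinom x e k)
    (hB : ∀ e, chainSum x 0 (2 * k + 1) (2 * e) = x ^ e * gaussBinom x e k)
    (hB' : ∀ e, chainSum x 0 (2 * k + 1) (2 * e + 1) = 0) (e : ℕ) :
    (chainSum x 1 (2 * (k + 1)) (2 * e) = gaussBinom x e (k + 1) ∧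
      chainSum x 1 (2 * (k + 1)) (2 * e + 1) = gaussBinom x e (k + 1)) ∧
    (chainSum x 0 (2 * (k + 1)) (2 * e) =
      gaussBinom x e (k + 1) * (x ^ e + x ^ (k + 1)) / (1 + x ^ (e + (k + 1))) ∧
      chainSum x 0 (2 * (k + 1)) (2 * e + 1) = x ^ (k + 1) * gaussBinom x e (k + 1)) := by
  rw [show 2 * (k + 1) = 2 * k + 1 + 1 by ring]
  have k1 : 1 - x ^ (2 * (k + 1)) ≠ 0 := hm (2 * k + 1)
  have stepA : ∀ e, chainSum x 1 (2 * k + 1 + 1) (2 * e) = gaussBinom x e (k + 1) →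
      chainSum x 1 (2 * k + 1 + 1) (2 * e + 1) = gaussBinom x e (k + 1) := by
    intro e h
    rw [chainSum_succ_succ, h, show 1 - 1 = 0 from rfl, hB']
    ring
  have stepB : ∀ e, chainSum x 0 (2 * k + 1 + 1) (2 * e) =
      gaussBinom x e (k + 1) * (x ^ e + x ^ (k + 1)) / (1 + x ^ (e + (k + 1))) →
      chainSum x 0 (2 * k + 1 + 1) (2 * e + 1) = x ^ (k + 1) * gaussBinom x e (k + 1) := by
    intro e h
    have n2 := hp (e + (k + 1))
    rw [chainSum_succ_succ, h, show 1 - 0 = 1 from rfl, hA',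
      show (2 * e + 1 + 0) / 2 = e by omega, Odd.neg_one_pow ⟨e, rfl⟩,
      gaussBinom_succ_right hm]
    field_simp
    ring
  suffices h : chainSum x 1 (2 * k + 1 + 1) (2 * e) = gaussBinom x e (k + 1) ∧
      chainSum x 0 (2 * k + 1 + 1) (2 * e) =
      gaussBinom x e (k + 1) * (x ^ e + x ^ (k + 1)) / (1 + x ^ (e + (k + 1))) from
    ⟨⟨h.1, stepA e h.1⟩, h.2, stepB e h.2⟩
  induction e with
  | zero =>
    have h0 := hB 0
    have h1 := hA 0
    rw [mul_zero] at h0 h1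
    constructor
    · rw [mul_zero, chainSum_succ_zero _ _ _ le_rfl, show 1 - 1 = 0 from rfl, h0,
        gaussBinom_zero_left hm, gaussBinom_zero_left hm]
      ring
    · rw [mul_zero, chainSum_succ_zero _ _ _ (by omega), show 1 - 0 = 1 from rfl, h1,
        gaussBinom_zero_left hm, gaussBinom_zero_left hm]
      have := hp (k + 1)
      simp only [pow_zero, zero_add]
      field_simp
  | succ e ih =>
    have hpos : ((-1 : K)) ^ (2 * e + 1 + 1) = 1 := Even.neg_one_pow ⟨e + 1, by ring⟩
    have n1 : 1 - x ^ (2 * (e + 1)) ≠ 0 := hm (2 * e + 1)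
    constructor
    · rw [show 2 * (e + 1) = 2 * e + 1 + 1 by ring, chainSum_succ_succ, stepA e ih.1,
        show 1 - 1 = 0 from rfl, show 2 * e + 1 + 1 = 2 * (e + 1) by ring, hB,
        show (2 * (e + 1) + 1) / 2 = e + 1 by omega,
        show 2 * (e + 1) = 2 * e + 1 + 1 by ring, hpos, gaussBinom_succ_left hm e (k + 1),
        gaussBinom_succ_right hm, gaussBinom_succ_left hm]
      field_simp
      ring
    · have n2 := hp (e + 1 + (k + 1))
      have hx := hm (e + k + 1)
      rw [show 2 * (e + 1) = 2 * e + 1 + 1 by ring, chainSum_succ_succ, stepB e ih.2,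
        show 1 - 0 = 1 from rfl, show 2 * e + 1 + 1 = 2 * (e + 1) by ring, hA,
        show 2 * (e + 1) / 2 = e + 1 by omega,
        show 2 * (e + 1) = 2 * e + 1 + 1 by ring, hpos, gaussBinom_succ_left hm e (k + 1),
        gaussBinom_succ_right hm, gaussBinom_succ_left hm]
      field_simp
      ring

-- The length grows by one at a time, alternating between the odd and even steps above. The fraction
-- at `s = 0` with even bound is the reason for assuming `1 + x ^ i ≠ 0`.
include hm hp in
theorem chainSum_even (k e : ℕ) :
    (chainSum x 1 (2 * k) (2 * e) = gaussBinom x e k ∧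
      chainSum x 1 (2 * k) (2 * e + 1) = gaussBinom x e k) ∧
    (chainSum x 0 (2 * k) (2 * e) = gaussBinom x e k * (x ^ e + x ^ k) / (1 + x ^ (e + k)) ∧
      chainSum x 0 (2 * k) (2 * e + 1) = x ^ k * gaussBinom x e k) := by
  induction k generalizing e with
  | zero =>
    have := hp e
    simp [chainSum, gaussBinom_zero_right hm]
    field_simp
    ring
  | succ k ih =>
    have h := chainSum_odd_of_even hm hp k (fun e => (ih e).1.1) (fun e => (ih e).1.2)
      (fun e => (ih e).2.1) fun e => (ih e).2.2
    exact chainSum_even_of_odd hm hp k (fun e => (h e).1.1) (fun e => (h e).1.2)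
      (fun e => (h e).2.1) (fun e => (h e).2.2) e

include hm hp in
theorem chainSum_odd (k e : ℕ) :
    (chainSum x 1 (2 * k + 1) (2 * e) = gaussBinom x e k ∧
      chainSum x 1 (2 * k + 1) (2 * e + 1) = (1 - x ^ (e + k + 1)) * gaussBinom x e k) ∧
    (chainSum x 0 (2 * k + 1) (2 * e) = x ^ e * gaussBinom x e k ∧
      chainSum x 0 (2 * k + 1) (2 * e + 1) = 0) := by
  have ih := chainSum_even hm hp k
  exact chainSum_odd_of_even hm hp k (fun e => (ih e).1.1) (fun e => (ih e).1.2)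
    (fun e => (ih e).2.1) (fun e => (ih e).2.2) e

end ClosedForms

/-! ### Counting pairs of positions; inversions -/

section PairCount

variable {α β : Type*}

open Classical in
/-- The number of pairs of positions `i < j` with `Q (i + j)` and `R (f i) (f j)`. -/
noncomputable def pairCount (Q : ℕ → Prop) (R : α → α → Prop) {n : ℕ} (f : Fin n → α) : ℕ :=
  ∑ j : Fin n, ∑ i : Fin n, if i < j ∧ Q ((i : ℕ) + j) ∧ R (f i) (f j) then 1 else 0

open Classical in
theorem pairCount_succ_last (Q : ℕ → Prop) (R : α → α → Prop) {n : ℕ} (f : Fin (n + 1) → α) :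
    pairCount Q R f = pairCount Q R (fun i : Fin n => f i.castSucc) +
      (Finset.univ.filter fun i : Fin n => Q (i + n) ∧ R (f i.castSucc) (f (Fin.last n))).card := by
  simp only [pairCount, Fin.sum_univ_castSucc, Finset.card_filter]
  have h : ∀ i : Fin n, ¬ Fin.last n < i.castSucc := fun i => (Fin.le_last _).not_gt
  simp [Fin.castSucc_lt_last, h]

-- Removing the first position shifts both indices of a remaining pair by one, so the index sum
-- drops by two; `Q` must have period two.
open Classical in
theorem pairCount_succ_first {Q : ℕ → Prop} (hQ : ∀ m, Q (m + 2) ↔ Q m) (R : α → α → Prop)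
    {n : ℕ} (f : Fin (n + 1) → α) :
    pairCount Q R f = pairCount Q R (fun i : Fin n => f i.succ) +
      (Finset.univ.filter fun i : Fin n => Q (i + 1) ∧ R (f 0) (f i.succ)).card := by
  have h : ∀ a b : ℕ, Q (a + 1 + (b + 1)) ↔ Q (a + b) := fun a b => by
    rw [← hQ (a + b), show a + 1 + (b + 1) = a + b + 2 by ring]
  simp only [pairCount, Fin.sum_univ_succ, Finset.card_filter]
  simp [h, Finset.sum_add_distrib, add_comm]

theorem pairCount_congr {Q : ℕ → Prop} {R : α → α → Prop} {S : β → β → Prop} {n : ℕ}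
    {f : Fin n → α} {g : Fin n → β}
    (h : ∀ i j : Fin n, i ≠ j → Q (i + j) → (R (f i) (f j) ↔ S (g i) (g j))) :
    pairCount Q R f = pairCount Q S g := by
  classical
  refine Finset.sum_congr rfl fun j _ => Finset.sum_congr rfl fun i _ => ?_
  refine if_congr ?_ rfl rfl
  constructor
  · rintro ⟨h1, h2, h3⟩
    exact ⟨h1, h2, (h i j h1.ne h2).1 h3⟩
  · rintro ⟨h1, h2, h3⟩
    exact ⟨h1, h2, (h i j h1.ne h2).2 h3⟩

-- Doubling replaces `i < j` by `i ≠ j`, a condition invariant under permutations of the positions;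
-- this is what makes `pairCount_comp_perm` a mere reindexing.
open Classical in
theorem two_mul_pairCount {Q : ℕ → Prop} {R : α → α → Prop} (hR : ∀ a b, R a b ↔ R b a)
    {n : ℕ} (f : Fin n → α) :
    2 * pairCount Q R f = ∑ j : Fin n, ∑ i : Fin n, if i ≠ j ∧ Q ((i : ℕ) + j) ∧ R (f i) (f j) then 1 else 0 := by
  have h : pairCount Q R f = ∑ j : Fin n, ∑ i, if j < i ∧ Q (i + j) ∧ R (f i) (f j) then 1 else 0 := by
    rw [pairCount, Finset.sum_comm]
    refine Finset.sum_congr rfl fun j _ => Finset.sum_congr rfl fun i _ => ?_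
    rw [hR, add_comm]
  rw [two_mul]
  nth_rewrite 2 [h]
  rw [pairCount, ← Finset.sum_add_distrib]
  refine Finset.sum_congr rfl fun j _ => ?_
  rw [← Finset.sum_add_distrib]
  refine Finset.sum_congr rfl fun i _ => ?_
  rcases lt_trichotomy i j with h1 | h1 | h1
  · simp [h1, h1.ne, h1.not_gt]
  · simp [h1]
  · simp [h1, h1.ne', h1.not_gt]

theorem pairCount_comp_perm {Q : ℕ → Prop} {R : α → α → Prop} (hR : ∀ a b, R a b ↔ R b a)
    {n : ℕ} (f : Fin n → α) (σ : Equiv.Perm (Fin n))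
    (hσ : ∀ i j : Fin n, Q (σ i + σ j) ↔ Q (i + j)) :
    pairCount Q R (f ∘ σ) = pairCount Q R f := by
  classical
  have h : 2 * pairCount Q R (f ∘ σ) = 2 * pairCount Q R f := by
    rw [two_mul_pairCount hR, two_mul_pairCount hR]
    conv_rhs => rw [← Equiv.sum_comp σ]
    refine Finset.sum_congr rfl fun j _ => ?_
    conv_rhs => rw [← Equiv.sum_comp σ]
    refine Finset.sum_congr rfl fun i _ => ?_
    simp only [Function.comp, hσ, ne_eq, EmbeddingLike.apply_eq_iff_eq]
  omega

/-- The number of inversions. -/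
noncomputable def inv [LinearOrder α] {n : ℕ} (f : Fin n → α) : ℕ :=
  pairCount (fun _ => True) (fun a b => b < a) f

/-- The number of inversions between positions of opposite parity. -/
noncomputable def oddInv [LinearOrder α] {n : ℕ} (f : Fin n → α) : ℕ :=
  pairCount Odd (fun a b => b < a) f

/-- Passing to the sign homomorphism makes the effect of exchanging two values immediate. -/
theorem neg_one_pow_inv {R : Type*} [CommRing R] {n : ℕ} (v : Equiv.Perm (Fin n)) :
    (-1 : R) ^ inv v = ((Equiv.Perm.sign v : ℤ) : R) := by
  classical
  have h : ((Equiv.Perm.sign v : ℤ)) = (-1) ^ inv v := by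
    rw [Equiv.Perm.sign_eq_prod_prod_Iio]
    push_cast
    rw [inv, pairCount, ← Finset.prod_pow_eq_pow_sum]
    refine Finset.prod_congr rfl fun j _ => ?_
    rw [← Finset.prod_pow_eq_pow_sum]
    refine Eq.trans ?_ (Finset.prod_subset (Finset.subset_univ (Finset.Iio j)) ?_)
    swap
    · intro i _ hi
      rw [Finset.mem_Iio] at hi
      simp [hi]
    refine Finset.prod_congr rfl fun i hi => ?_
    rw [Finset.mem_Iio] at hi
    rcases lt_trichotomy (v i) (v j) with h1 | h1 | h1
    · simp [h1, h1.not_gt]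
    · exact absurd (v.injective h1) hi.ne
    · simp [h1, h1.not_gt, hi]
  rw [h]
  push_cast
  rfl

/-- After reindexing by the swap, the entries stay put and the comparison of positions changes.
Swapping adjacent positions alters the order of the pair `(k, l)` only, which yields the single
correction term in `h2`. -/
theorem inv_comp_swap_of_lt [LinearOrder α] {n : ℕ} (f : Fin n → α) (k l : Fin n)
    (hkl : (k : ℕ) + 1 = l) (h : f k < f l) : inv (f ∘ Equiv.swap k l) = inv f + 1 := by
  classical
  have h1 : inv (f ∘ Equiv.swap k l) =
      ∑ j, ∑ i, if Equiv.swap k l i < Equiv.swap k l j ∧ f j < f i then 1 else 0 := by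
    rw [inv, pairCount, ← Equiv.sum_comp (Equiv.swap k l)]
    refine Finset.sum_congr rfl fun j _ => ?_
    rw [← Equiv.sum_comp (Equiv.swap k l)]
    simp
  have h2 : ∀ i j : Fin n,
      (if Equiv.swap k l i < Equiv.swap k l j ∧ f j < f i then 1 else 0) =
      (if i < j ∧ True ∧ f j < f i then 1 else 0) + if j = k then (if i = l then 1 else 0) else 0 := by
    intro i j
    have hne : k ≠ l := fun h => by rw [h] at hkl; omega
    have hkl' : k < l := by rw [Fin.lt_def]; omega
    by_cases hjk : j = k
    · subst hjk
      by_cases hil : i = l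
      · subst hil
        simp [h, hkl', hkl'.not_gt]
      · by_cases hij : i = j
        · subst hij; simp [hil]
        · have : (i < l) ↔ i < j := by
            rw [Fin.lt_def, Fin.lt_def]
            have : (i : ℕ) ≠ j := fun h => hij (Fin.ext h)
            omega
          simp [hil, Equiv.swap_apply_of_ne_of_ne hij hil, this]
    · by_cases hjl : j = l
      · subst hjl
        by_cases hik : i = k
        · subst hik
          simp [hjk, h.not_gt]
        · by_cases hij : i = j
          · subst hij; simp [hjk]
          · have : (i < k) ↔ i < j := by
              rw [Fin.lt_def, Fin.lt_def]
              have : (i : ℕ) ≠ k := fun h => hik (Fin.ext h)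
              omega
            simp [hjk, Equiv.swap_apply_of_ne_of_ne hik hij, this]
      · have hj1 : (j : ℕ) ≠ k := fun h => hjk (Fin.ext h)
        have hj2 : (j : ℕ) ≠ l := fun h => hjl (Fin.ext h)
        rw [Equiv.swap_apply_of_ne_of_ne hjk hjl]
        by_cases hik : i = k
        · subst hik
          have : (l < j) ↔ i < j := by rw [Fin.lt_def, Fin.lt_def]; omega
          simp [hjk, this]
        · by_cases hil : i = l
          · subst hil
            have : (k < j) ↔ i < j := by rw [Fin.lt_def, Fin.lt_def]; omega
            simp [hjk, this]
          · simp [Equiv.swap_apply_of_ne_of_ne hik hil, hjk]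
  rw [h1, inv, pairCount]
  simp_rw [h2, Finset.sum_add_distrib]
  simp

theorem inv_lt_inv_comp_swap_iff [LinearOrder α] {n : ℕ} (f : Fin n → α)
    (hf : Function.Injective f) (k l : Fin n) (hkl : (k : ℕ) + 1 = l) :
    inv f < inv (f ∘ Equiv.swap k l) ↔ f k < f l := by
  constructor
  · intro h
    by_contra hlt
    have hne : k ≠ l := fun h => by rw [h] at hkl; omega
    have h1 : f l < f k := lt_of_le_of_ne (not_lt.1 hlt) fun h => hne (hf h).symm
    have h2 := inv_comp_swap_of_lt (f ∘ Equiv.swap k l) k l hkl (by simpa using h1)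
    rw [Function.comp_assoc, ← Equiv.coe_trans, Equiv.swap_swap, Equiv.coe_refl,
      Function.comp_id] at h2
    omega
  · intro h
    rw [inv_comp_swap_of_lt f k l hkl h]
    omega

theorem pairCount_comp_strictMono [LinearOrder α] [LinearOrder β] (Q : ℕ → Prop) {n : ℕ}
    (f : Fin n → α) {u : α → β} (hu : StrictMono u) :
    pairCount Q (fun a b => b < a) (u ∘ f) = pairCount Q (fun a b => b < a) f :=
  pairCount_congr fun _ _ _ _ => hu.lt_iff_lt

end PairCount

/-! ### The sign-reversing involution and chessboard permutations -/

section Cancellation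

variable {n : ℕ}

/-- The values `i` and `i + 1` occupy positions of the same parity. -/
def SameParity (v : Equiv.Perm (Fin n)) (i : ℕ) : Prop :=
  ∃ p q : Fin n, (v p : ℕ) = i ∧ (v q : ℕ) = i + 1 ∧ (p : ℕ) % 2 = q % 2

/-- Consecutive values occupy positions of opposite parity. -/
def Chessboard (v : Equiv.Perm (Fin n)) : Prop := ∀ i, ¬ SameParity v i

/-- The permutation exchanging the values `i` and `i + 1`, if these lie in range. -/
def adjSwap (n i : ℕ) : Equiv.Perm (Fin n) :=
  if h : i + 1 < n then Equiv.swap ⟨i, by omega⟩ ⟨i + 1, h⟩ else 1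

theorem adjSwap_mul_self (i : ℕ) : adjSwap n i * adjSwap n i = 1 := by
  unfold adjSwap
  split_ifs <;> simp

theorem SameParity.lt {v : Equiv.Perm (Fin n)} {i : ℕ} (h : SameParity v i) : i + 1 < n := by
  obtain ⟨p, q, h1, h2, h3⟩ := h
  have := (v q).2
  omega

theorem adjSwap_val {i : ℕ} (hi : i + 1 < n) (a : Fin n) :
    ((adjSwap n i a : Fin n) : ℕ) =
      if (a : ℕ) = i then i + 1 else if (a : ℕ) = i + 1 then i else a := by
  rw [adjSwap, dif_pos hi, Equiv.swap_apply_def]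
  simp only [Fin.ext_iff]
  split_ifs <;> rfl

theorem sign_adjSwap {i : ℕ} (hi : i + 1 < n) : Equiv.Perm.sign (adjSwap n i) = -1 := by
  rw [adjSwap, dif_pos hi, Equiv.Perm.sign_swap]
  simp [Fin.ext_iff]

theorem exists_apply_val_eq (v : Equiv.Perm (Fin n)) {i : ℕ} (hi : i < n) :
    ∃ p, (v p : ℕ) = i := ⟨v.symm ⟨i, hi⟩, by simp⟩

theorem val_injective (v : Equiv.Perm (Fin n)) {p q : Fin n} (h : (v p : ℕ) = v q) : p = q :=
  v.injective (Fin.ext h)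

/-- Exchanging the values `i` and `i + 1` in positions `p` and `q` of the same parity amounts to a
parity-preserving permutation of the positions. -/
theorem exists_comp_of_sameParity {v : Equiv.Perm (Fin n)} {i : ℕ} (h : SameParity v i) :
    ∃ σ : Equiv.Perm (Fin n), adjSwap n i * v = v * σ ∧ ∀ k, (σ k : ℕ) % 2 = k % 2 := by
  have hi := h.lt
  obtain ⟨p, q, h1, h2, h3⟩ := h
  refine ⟨Equiv.swap p q, ?_, ?_⟩
  · have hp : v p = ⟨i, by omega⟩ := Fin.ext h1
    have hq : v q = ⟨i + 1, hi⟩ := Fin.ext h2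
    rw [adjSwap, dif_pos hi, ← hp, ← hq, Equiv.Perm.mul_def, Equiv.Perm.mul_def]
    ext k
    simp [Equiv.swap_apply_def]
    split_ifs <;> simp_all
  · intro k
    rw [Equiv.swap_apply_def]
    split_ifs with hk1 hk2
    · rw [hk1, h3]
    · rw [hk2, h3]
    · rfl

/-- Exchanging the values `i` and `i + 1` in positions of the same parity does not affect the
relative order in positions of opposite parity. -/
theorem adjSwap_lt_iff {v : Equiv.Perm (Fin n)} {i : ℕ} (h : SameParity v i) {a b : Fin n}
    (hab : Odd ((a : ℕ) + b)) :
    (adjSwap n i * v) a < (adjSwap n i * v) b ↔ v a < v b := by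
  have hi := h.lt
  obtain ⟨p, q, h1, h2, h3⟩ := h
  rw [Equiv.Perm.mul_apply, Equiv.Perm.mul_apply, Fin.lt_def, Fin.lt_def, adjSwap_val hi,
    adjSwap_val hi]
  have hab2 : ¬ ((a : ℕ) % 2 = b % 2) := by
    rw [Nat.odd_iff] at hab
    omega
  have key : ¬ ((v a : ℕ) = i ∧ (v b : ℕ) = i + 1) := by
    rintro ⟨e1, e2⟩
    rw [val_injective v (e1.trans h1.symm), val_injective v (e2.trans h2.symm)] at hab2
    exact hab2 h3
  have key2 : ¬ ((v a : ℕ) = i + 1 ∧ (v b : ℕ) = i) := by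
    rintro ⟨e1, e2⟩
    rw [val_injective v (e1.trans h2.symm), val_injective v (e2.trans h1.symm)] at hab2
    exact hab2 h3.symm
  split_ifs <;> omega

/-- The exchange is a parity-preserving rearrangement of positions, so every value pair keeps its
status. In particular the least index with equal parities does not change, as the involution
requires. -/
theorem sameParity_adjSwap_mul {v : Equiv.Perm (Fin n)} {i : ℕ} (h : SameParity v i) (l : ℕ) :
    SameParity (adjSwap n i * v) l ↔ SameParity v l := by
  have aux : ∀ {v : Equiv.Perm (Fin n)}, SameParity v i → SameParity (adjSwap n i * v) l →
      SameParity v l := by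
    intro v h hl
    obtain ⟨σ, h1, h2⟩ := exists_comp_of_sameParity h
    obtain ⟨p, q, e1, e2, e3⟩ := hl
    rw [h1] at e1 e2
    exact ⟨σ p, σ q, e1, e2, by rw [h2, h2, e3]⟩
  refine ⟨aux h, fun hl => ?_⟩
  have h' : SameParity (adjSwap n i * v) i := by
    have hi := h.lt
    obtain ⟨p, q, e1, e2, e3⟩ := h
    refine ⟨q, p, ?_, ?_, e3.symm⟩
    · rw [Equiv.Perm.mul_apply, adjSwap_val hi, if_neg (by omega), if_pos e2]
    · rw [Equiv.Perm.mul_apply, adjSwap_val hi, if_pos e1]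
  refine aux h' ?_
  rwa [← mul_assoc, adjSwap_mul_self, one_mul]

open Classical in
/-- A sum over all permutations that is antisymmetric under the exchange of adjacent values in
positions of the same parity is supported on the chessboard permutations. -/
theorem sum_eq_sum_chessboard {R : Type*} [AddCommGroup R] (g : Equiv.Perm (Fin n) → R)
    (hg : ∀ v i, SameParity v i → g (adjSwap n i * v) = -g v) :
    ∑ v, g v = ∑ v with Chessboard v, g v := by
  rw [← Finset.sum_filter_add_sum_filter_not Finset.univ Chessboard g]
  rw [add_eq_left]
  have hex : ∀ v : Equiv.Perm (Fin n), v ∈ Finset.univ.filter (fun v => ¬ Chessboard v) →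
      ∃ i, SameParity v i := by
    intro v hv
    simpa [Chessboard] using hv
  -- The partner of `v` exchanges the values at the least `i` with `SameParity v i`; a fixed point
  -- would make a transposition equal to `1`, contradicting its sign.
  refine Finset.sum_involution (fun v hv => adjSwap n (Nat.find (hex v hv)) * v) ?_ ?_ ?_ ?_
  · intro v hv
    rw [hg v _ (Nat.find_spec (hex v hv))]
    simp
  · intro v hv _ heq
    have hi := (Nat.find_spec (hex v hv)).lt
    have h1 : adjSwap n (Nat.find (hex v hv)) = 1 := by
      simpa using heq
    have h2 := sign_adjSwap hi
    rw [h1, Equiv.Perm.sign_one] at h2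
    exact absurd h2 (by decide)
  · intro v hv
    have hs := Nat.find_spec (hex v hv)
    simp only [Finset.mem_filter, Finset.mem_univ, true_and, Chessboard, not_forall, not_not]
    exact ⟨_, (sameParity_adjSwap_mul hs _).2 hs⟩
  · intro v hv
    have hs := Nat.find_spec (hex v hv)
    have : ∀ h : ∃ i, SameParity (adjSwap n (Nat.find (hex v hv)) * v) i,
        Nat.find h = Nat.find (hex v hv) := fun h =>
      Nat.find_congr' (sameParity_adjSwap_mul hs _)
    rw [this, ← mul_assoc, adjSwap_mul_self, one_mul]

/-- A permutation is increasing across the adjacent positions indexed by `I`. -/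
def IncreasingOn (I : Finset ℕ) (v : Equiv.Perm (Fin n)) : Prop :=
  ∀ a b : Fin n, (a : ℕ) + 1 = b → (b : ℕ) ∈ I → v a < v b

/-- Adjacent positions have odd index sum, so their relative order survives the exchange. -/
theorem increasingOn_adjSwap_mul (I : Finset ℕ) {v : Equiv.Perm (Fin n)} {i : ℕ}
    (h : SameParity v i) : IncreasingOn I (adjSwap n i * v) ↔ IncreasingOn I v := by
  refine forall_congr' fun a => forall_congr' fun b => forall_congr' fun hab =>
    forall_congr' fun _ => adjSwap_lt_iff h ⟨a, by omega⟩

/-- The summand of the generating function of the odd inversion number. -/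
noncomputable def weight {K : Type*} [CommRing K] (x : K) (v : Equiv.Perm (Fin n)) : K :=
  (-1) ^ inv v * x ^ oddInv v

theorem weight_adjSwap_mul {K : Type*} [CommRing K] (x : K) {v : Equiv.Perm (Fin n)} {i : ℕ}
    (h : SameParity v i) : weight x (adjSwap n i * v) = -weight x v := by
  have : oddInv (adjSwap n i * v) = oddInv v :=
    pairCount_congr fun a b _ hab => adjSwap_lt_iff h (by rwa [add_comm])
  rw [weight, weight, this, neg_one_pow_inv, neg_one_pow_inv, Equiv.Perm.sign_mul,
    sign_adjSwap h.lt]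
  simp

/-- Position parity alternates along the values `0, 1, 2, …`, so the position of `0` determines it
for every value. -/
theorem Chessboard.parity {v : Equiv.Perm (Fin n)} (h : Chessboard v) (p : Fin n) (i : ℕ)
    (q : Fin n) (hp : (v p : ℕ) = 0) (hq : (v q : ℕ) = i) :
    (q : ℕ) % 2 = (p + i) % 2 := by
  induction i generalizing q with
  | zero => rw [val_injective v (hq.trans hp.symm), add_zero]
  | succ i ih =>
    obtain ⟨r, hr⟩ := exists_apply_val_eq v (i := i) (by have := (v q).2; omega)
    have h1 := ih r hr
    have h2 : ¬ ((r : ℕ) % 2 = q % 2) := fun h3 => h i ⟨r, q, hr, hq, h3⟩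
    omega

/-- The value `0`, if there is one, occupies an even position. -/
def ZeroEven (v : Equiv.Perm (Fin n)) : Prop := ∀ p, (v p : ℕ) = 0 → (p : ℕ) % 2 = 0

theorem Chessboard.parity_eq {v : Equiv.Perm (Fin n)} (h : Chessboard v) (h0 : ZeroEven v)
    (q : Fin n) : (v q : ℕ) % 2 = q % 2 := by
  obtain ⟨p, hp⟩ := exists_apply_val_eq v (i := 0) (by have := q.2; omega)
  have h1 := h.parity p _ q hp rfl
  have h2 := h0 p hp
  omega

theorem Chessboard.parity_eq_succ {v : Equiv.Perm (Fin n)} (h : Chessboard v)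
    (h0 : ¬ ZeroEven v) (q : Fin n) : (v q : ℕ) % 2 = (q + 1) % 2 := by
  obtain ⟨p, hp, h2⟩ : ∃ p, (v p : ℕ) = 0 ∧ ¬ ((p : ℕ) % 2 = 0) := by
    simpa [ZeroEven] using h0
  have h1 := h.parity p _ q hp rfl
  omega

theorem Chessboard.odd_add {v : Equiv.Perm (Fin n)} (h : Chessboard v) (a b : Fin n) :
    Odd ((v a : ℕ) + v b) ↔ Odd ((a : ℕ) + b) := by
  rw [Nat.odd_iff, Nat.odd_iff]
  by_cases h0 : ZeroEven v
  · have h1 := h.parity_eq h0 a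
    have h2 := h.parity_eq h0 b
    omega
  · have h1 := h.parity_eq_succ h0 a
    have h2 := h.parity_eq_succ h0 b
    omega

/-- A parity-reversing permutation negates `∑ (-1) ^ i`, yet a permutation preserves it; for odd `n`
this sum is `1`. -/
theorem Chessboard.even_of_not_zeroEven {v : Equiv.Perm (Fin n)} (h : Chessboard v)
    (h0 : ¬ ZeroEven v) : n % 2 = 0 := by
  by_contra hn
  have h1 : ∑ i : Fin n, (-1 : ℤ) ^ (v i : ℕ) = ∑ i : Fin n, (-1 : ℤ) ^ (i : ℕ) :=
    Equiv.sum_comp v fun i : Fin n => (-1 : ℤ) ^ (i : ℕ)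
  have h2 : ∑ i : Fin n, (-1 : ℤ) ^ (v i : ℕ) = -∑ i : Fin n, (-1 : ℤ) ^ (i : ℕ) := by
    rw [← Finset.sum_neg_distrib]
    refine Finset.sum_congr rfl fun i _ => ?_
    have h3 := h.parity_eq_succ h0 i
    rw [neg_one_pow_eq_pow_mod_two, h3, ← neg_one_pow_eq_pow_mod_two, pow_succ]
    ring
  have h3 : ∑ i : Fin n, (-1 : ℤ) ^ (i : ℕ) = 1 := by
    rw [Fin.sum_univ_eq_sum_range (fun i => (-1 : ℤ) ^ i)]
    rw [neg_one_geom_sum, if_neg]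
    rw [Nat.even_iff]
    omega
  omega

theorem zeroEven_adjSwap_mul {v : Equiv.Perm (Fin n)} {i : ℕ} (h : SameParity v i) :
    ZeroEven (adjSwap n i * v) ↔ ZeroEven v := by
  obtain ⟨σ, h1, h2⟩ := exists_comp_of_sameParity h
  rw [h1]
  constructor
  · intro hz p hp
    have := hz (σ.symm p) (by simpa using hp)
    rw [← h2, Equiv.apply_symm_apply] at this
    exact this
  · intro hz p hp
    rw [← h2]
    exact hz (σ p) hp

end Cancellation

/-! ### Building permutations by appending a last entry -/

section InsertLast

variable {n : ℕ}

/-- The permutation with last value `j` whose other values are in the same relative order as those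
of `v`. -/
def insertLast (v : Equiv.Perm (Fin n)) (j : Fin (n + 1)) : Equiv.Perm (Fin (n + 1)) :=
  (finSuccEquiv' (Fin.last n)).trans ((Equiv.optionCongr v).trans (finSuccEquiv' j).symm)

@[simp]
theorem insertLast_castSucc (v : Equiv.Perm (Fin n)) (j : Fin (n + 1)) (i : Fin n) :
    insertLast v j i.castSucc = j.succAbove (v i) := by
  simp [insertLast, finSuccEquiv'_last_apply_castSucc]

@[simp]
theorem insertLast_last (v : Equiv.Perm (Fin n)) (j : Fin (n + 1)) :
    insertLast v j (Fin.last n) = j := by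
  simp [insertLast, finSuccEquiv'_at]

theorem insertLast_bijective :
    Function.Bijective fun p : Equiv.Perm (Fin n) × Fin (n + 1) => insertLast p.1 p.2 := by
  rw [Fintype.bijective_iff_injective_and_card]
  constructor
  · rintro ⟨v, j⟩ ⟨v', j'⟩ h
    have hj : j = j' := by
      have := DFunLike.congr_fun h (Fin.last n)
      simpa using this
    subst hj
    refine Prod.ext (Equiv.ext fun i => ?_) rfl
    have := DFunLike.congr_fun h i.castSucc
    simpa using this
  · simp [Fintype.card_perm, Nat.factorial_succ, mul_comm]

theorem sum_perm_succ {R : Type*} [AddCommMonoid R] (g : Equiv.Perm (Fin (n + 1)) → R) :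
    ∑ v, g v = ∑ v : Equiv.Perm (Fin n), ∑ j, g (insertLast v j) := by
  rw [← Fintype.sum_prod_type']
  exact (Fintype.sum_bijective _ insertLast_bijective _ _ fun _ => rfl).symm

theorem val_succAbove (j : Fin (n + 1)) (a : Fin n) :
    ((j.succAbove a : Fin (n + 1)) : ℕ) = if (a : ℕ) < j then (a : ℕ) else a + 1 := by
  simp only [Fin.succAbove, Fin.lt_def, Fin.val_castSucc]
  split_ifs <;> simp

theorem increasingOn_insertLast (I : Finset ℕ) (v : Equiv.Perm (Fin n)) (j : Fin (n + 1)) :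
    IncreasingOn I (insertLast v j) ↔ IncreasingOn I v ∧
      ∀ a : Fin n, (a : ℕ) + 1 = n → n ∈ I → (v a : ℕ) < j := by
  constructor
  · intro h
    constructor
    · intro a b hab hb
      have := h a.castSucc b.castSucc hab hb
      simpa using this
    · intro a ha hn
      have := h a.castSucc (Fin.last n) ha hn
      rw [insertLast_castSucc, insertLast_last, Fin.lt_def, val_succAbove] at this
      split_ifs at this with h1
      · exact h1
      · omega
  · rintro ⟨h1, h2⟩ a b hab hb
    induction b using Fin.lastCases with
    | last =>
      induction a using Fin.lastCases with
      | last => simp at hab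
      | cast a =>
        have := h2 a hab hb
        rw [insertLast_castSucc, insertLast_last, Fin.lt_def, val_succAbove, if_pos this]
        exact this
    | cast b =>
      induction a using Fin.lastCases with
      | last =>
        have := b.2
        simp at hab
        omega
      | cast a => simpa using h1 a b hab hb

/-- Appending `j ≠ 0` leaves the old `0` in place; appending `j = 0` puts the value `0` at position
`n`. -/
theorem zeroEven_insertLast (v : Equiv.Perm (Fin n)) (j : Fin (n + 1)) :
    ZeroEven (insertLast v j) ↔ if (j : ℕ) = 0 then n % 2 = 0 else ZeroEven v := by
  split_ifs with hj
  · constructor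
    · intro h
      simpa using h (Fin.last n) (by rw [insertLast_last, hj])
    · intro h p hp
      induction p using Fin.lastCases with
      | last => simpa using h
      | cast p =>
        rw [insertLast_castSucc, val_succAbove, hj] at hp
        simp at hp
  · constructor
    · intro h p hp
      have := h p.castSucc (by
        rw [insertLast_castSucc, val_succAbove, if_pos (by omega), hp])
      simpa using this
    · intro h p hp
      induction p using Fin.lastCases with
      | last =>
        rw [insertLast_last] at hp
        exact absurd hp hj
      | cast p =>
        rw [insertLast_castSucc, val_succAbove] at hp
        split_ifs at hp with h1
        exact h p hp

/-- The number of the `d` largest values lying in positions of the parity of `p`. -/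
def countAbove (v : Equiv.Perm (Fin n)) (p d : ℕ) : ℕ :=
  (Finset.univ.filter fun i : Fin n => (i : ℕ) % 2 = p % 2 ∧ n ≤ v i + d).card

/-- The appended `j` lies below the `d` largest values, which are the former ones shifted up by one.
Since the counts `d` decrease weakly along an increasing block, all its weights can be read off from
the initial `v`. -/
theorem countAbove_insertLast (v : Equiv.Perm (Fin n)) (j : Fin (n + 1)) (p d : ℕ)
    (hd : d ≤ n - j) : countAbove (insertLast v j) p d = countAbove v p d := by
  rw [countAbove, countAbove, Finset.card_filter, Finset.card_filter, Fin.sum_univ_castSucc]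
  have hj := j.2
  rw [if_neg (by rw [insertLast_last]; omega), add_zero]
  refine Finset.sum_congr rfl fun i _ => if_congr ?_ rfl rfl
  rw [insertLast_castSucc, val_succAbove, Fin.val_castSucc]
  split_ifs <;> omega

theorem card_filter_le_perm (v : Equiv.Perm (Fin n)) (j : Fin (n + 1)) :
    (Finset.univ.filter fun i : Fin n => (j : ℕ) ≤ v i).card = n - j := by
  have h1 : (Finset.univ.filter fun i : Fin n => (j : ℕ) ≤ v i).card =
      (Finset.univ.filter fun i : Fin n => (j : ℕ) ≤ i).card := by
    rw [Finset.card_filter, Finset.card_filter]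
    exact Equiv.sum_comp v fun i : Fin n => if (j : ℕ) ≤ i then 1 else 0
  rw [h1, Finset.card_filter, Fin.sum_univ_eq_sum_range (fun i => if (j : ℕ) ≤ i then 1 else 0),
    ← Finset.card_filter, show (Finset.range n).filter (fun i => (j : ℕ) ≤ i) = Finset.Ico (j : ℕ) n
      by ext; simp [and_comm], Nat.card_Ico]

theorem inv_insertLast (v : Equiv.Perm (Fin n)) (j : Fin (n + 1)) :
    inv (insertLast v j) = inv v + (n - j) := by
  classical
  rw [inv, pairCount_succ_last, ← card_filter_le_perm v j]
  congr 1
  · exact pairCount_congr fun a b _ _ => by simp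
  · congr 1
    ext i
    simp only [Finset.mem_filter, Finset.mem_univ, true_and, insertLast_castSucc, insertLast_last,
      Fin.lt_def, val_succAbove]
    split_ifs <;> omega

theorem oddInv_insertLast (v : Equiv.Perm (Fin n)) (j : Fin (n + 1)) :
    oddInv (insertLast v j) = oddInv v + countAbove v (n + 1) (n - j) := by
  classical
  rw [oddInv, pairCount_succ_last, countAbove]
  congr 1
  · exact pairCount_congr fun a b _ _ => by simp
  · congr 1
    ext i
    simp only [Finset.mem_filter, Finset.mem_univ, true_and, insertLast_castSucc, insertLast_last,
      Fin.lt_def, val_succAbove, Nat.odd_iff]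
    split_ifs <;> omega

theorem weight_insertLast {K : Type*} [CommRing K] (x : K) (v : Equiv.Perm (Fin n))
    (j : Fin (n + 1)) : weight x (insertLast v j) =
      weight x v * ((-1) ^ (n - j : ℕ) * x ^ countAbove v (n + 1) (n - j)) := by
  rw [weight, weight, inv_insertLast, oddInv_insertLast]
  ring

theorem countAbove_adjSwap_mul {v : Equiv.Perm (Fin n)} {i : ℕ} (h : SameParity v i) (p d : ℕ) :
    countAbove (adjSwap n i * v) p d = countAbove v p d := by
  obtain ⟨σ, h1, h2⟩ := exists_comp_of_sameParity h
  rw [h1, countAbove, countAbove, Finset.card_filter, Finset.card_filter]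
  conv_rhs => rw [← Equiv.sum_comp σ]
  exact Finset.sum_congr rfl fun i _ => if_congr (by rw [h2]; rfl) rfl rfl

/-- Among the last `d` positions, those with the parity of the final position `n - 1`, that is of `n
+ 1`, get the larger half. -/
theorem card_filter_parity_le (n p d : ℕ) (hd : d ≤ n) :
    (Finset.univ.filter fun i : Fin n => (i : ℕ) % 2 = p % 2 ∧ n ≤ i + d).card =
      (d + if p % 2 = (n + 1) % 2 then 1 else 0) / 2 := by
  rw [Finset.card_filter,
    Fin.sum_univ_eq_sum_range (fun i => if i % 2 = p % 2 ∧ n ≤ i + d then 1 else 0)]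
  induction d with
  | zero =>
    rw [Finset.sum_eq_zero]
    · split_ifs <;> rfl
    · intro i hi
      rw [Finset.mem_range] at hi
      rw [if_neg (by omega)]
  | succ d ih =>
    -- Raising `d` by one admits exactly the position `n - d - 1`.
    have h1 : ∀ i, (if i % 2 = p % 2 ∧ n ≤ i + (d + 1) then 1 else 0) =
        (if i % 2 = p % 2 ∧ n ≤ i + d then 1 else 0) +
          if i = n - d - 1 then (if (n - d - 1) % 2 = p % 2 then 1 else 0) else 0 := by
      intro i
      split_ifs <;> omega
    simp_rw [h1]
    rw [Finset.sum_add_distrib, ih (by omega), Finset.sum_ite_eq',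
      if_pos (Finset.mem_range.2 (by omega))]
    split_ifs <;> omega

/-- Here `v` preserves parity, so the large values may be replaced by the large positions; when `v`
reverses parity the same count applies with `p + 1`. -/
theorem countAbove_of_zeroEven {v : Equiv.Perm (Fin n)} (h : Chessboard v) (h0 : ZeroEven v)
    (p d : ℕ) (hd : d ≤ n) :
    countAbove v p d = (d + if p % 2 = (n + 1) % 2 then 1 else 0) / 2 := by
  rw [← card_filter_parity_le n p d hd, countAbove, Finset.card_filter, Finset.card_filter]
  conv_rhs => rw [← Equiv.sum_comp v]
  simp [h.parity_eq h0]

theorem countAbove_of_not_zeroEven {v : Equiv.Perm (Fin n)} (h : Chessboard v)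
    (h0 : ¬ ZeroEven v) (p d : ℕ) (hd : d ≤ n) :
    countAbove v p d = (d + if p % 2 = n % 2 then 1 else 0) / 2 := by
  have h1 := card_filter_parity_le n (p + 1) d hd
  have h2 : (p + 1) % 2 = (n + 1) % 2 ↔ p % 2 = n % 2 := by omega
  simp only [h2] at h1
  rw [← h1, countAbove, Finset.card_filter, Finset.card_filter]
  conv_rhs => rw [← Equiv.sum_comp v]
  refine Finset.sum_congr rfl fun i _ => if_congr ?_ rfl rfl
  have := h.parity_eq_succ h0 i
  omega

end InsertLast

/-! ### Appending an increasing block: the recursion for the totals -/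

section BlockSum

variable {K : Type*} [Field K] (x : K)

/-- The sum of the weights of all permutations obtained from `v` by appending an increasing block
of length `q` whose first value is among the `D + 1` largest choices. -/
noncomputable def blockSum : (q : ℕ) → {n : ℕ} → Equiv.Perm (Fin n) → ℕ → K
  | 0, _, v, _ => weight x v
  | q + 1, n, v, D =>
    ∑ j : Fin (n + 1), if n - j ≤ D then blockSum q (insertLast v j) (n - j) else 0

/-- The sum over weakly decreasing sequences `D ≥ d₁ ≥ … ≥ d_q ≥ 0` of the weights
`(-1)^{Σ dᵢ} x^{Σ C (p + i) dᵢ}`. -/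
def chainSumOf (C : ℕ → ℕ → ℕ) : ℕ → ℕ → ℕ → K
  | _, 0, _ => 1
  | p, q + 1, D =>
    ∑ d ∈ Finset.range (D + 1), (-1) ^ d * x ^ C (p + 1) d * chainSumOf C (p + 1) q d

theorem sum_fin_reverse (n : ℕ) (F : ℕ → K) :
    ∑ j : Fin (n + 1), F (n - j) = ∑ d ∈ Finset.range (n + 1), F d := by
  rw [Fin.sum_univ_eq_sum_range (fun j => F (n - j))]
  have := Finset.sum_range_reflect F (n + 1)
  simpa using this

theorem blockSum_eq (C : ℕ → ℕ → ℕ) (q n : ℕ) (v : Equiv.Perm (Fin n)) (D : ℕ) (hD : D ≤ n)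
    (hC : ∀ p, ∀ d ≤ D, countAbove v p d = C p d) :
    blockSum x q v D = weight x v * chainSumOf x C n q D := by
  induction q generalizing n D with
  | zero => simp [blockSum, chainSumOf]
  | succ q ih =>
    have h1 : ∀ j : Fin (n + 1),
        (if n - j ≤ D then blockSum x q (insertLast v j) (n - j) else 0) =
        (fun d => if d ≤ D then weight x v *
          ((-1) ^ d * x ^ C (n + 1) d * chainSumOf x C (n + 1) q d) else 0) (n - j) := by
      intro j
      refine if_ctx_congr Iff.rfl (fun hj => ?_) fun _ => rfl
      rw [ih (n + 1) _ _ (by omega), weight_insertLast, hC _ _ hj]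
      · ring
      · intro p d hd
        rw [countAbove_insertLast v j p d hd, hC p d (hd.trans hj)]
    rw [blockSum, Finset.sum_congr rfl fun j _ => h1 j]
    refine (sum_fin_reverse n fun d => if d ≤ D then weight x v *
      ((-1) ^ d * x ^ C (n + 1) d * chainSumOf x C (n + 1) q d) else 0).trans ?_
    rw [chainSumOf, Finset.mul_sum, ← Finset.sum_filter]
    refine Finset.sum_congr ?_ fun _ _ => rfl
    ext d
    simp only [Finset.mem_filter, Finset.mem_range]
    omega

/-- Rounding up occurs in positions with the parity of `p + s`. Advancing `p` by one while keeping
that parity class turns `s` into `1 - s`. -/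
theorem chainSumOf_eq (C : ℕ → ℕ → ℕ) (p q D s : ℕ) (hs : s ≤ 1)
    (hC : ∀ r, ∀ d ≤ D, C r d = (d + if r % 2 = (p + s) % 2 then 1 else 0) / 2) :
    chainSumOf x C p q D = chainSum x s q D := by
  induction q generalizing p D s with
  | zero => simp [chainSumOf, chainSum]
  | succ q ih =>
    rw [chainSumOf, chainSum]
    refine Finset.sum_congr rfl fun d hd => ?_
    rw [Finset.mem_range] at hd
    rw [hC (p + 1) d (by omega), ih (p + 1) d (1 - s) (by omega)]
    · congr 3
      split_ifs <;> omega
    · intro r d' hd'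
      rw [hC r d' (by omega)]
      congr 2
      refine if_congr ?_ rfl rfl
      omega

open Classical in
/-- The weighted sum over the permutations of degree `n` that are increasing across `I`. -/
noncomputable def total (φ : ∀ n : ℕ, Equiv.Perm (Fin n) → K) (I : Finset ℕ) (n : ℕ) : K :=
  ∑ v : Equiv.Perm (Fin n), if IncreasingOn I v then φ n v * weight x v else 0

-- The next entry `j` continues the increase exactly when `n + 1 - j ≤ n - v (last)`, which explains
-- the bound passed to `blockSum`. Later entries of the block exceed an earlier one and so are
-- nonzero, the only case in which `hφ` is needed.
open Classical in
theorem total_append (φ : ∀ n : ℕ, Equiv.Perm (Fin n) → K)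
    (hφ : ∀ n (v : Equiv.Perm (Fin (n + 1))) (j : Fin (n + 1 + 1)), (j : ℕ) ≠ 0 →
      φ (n + 1 + 1) (insertLast v j) = φ (n + 1) v)
    (I : Finset ℕ) (q n : ℕ) (hI : ∀ i, n < i → i ≤ n + q → i ∈ I) :
    total x φ I (n + 1 + q) = ∑ v : Equiv.Perm (Fin (n + 1)), if IncreasingOn I v then
      φ (n + 1) v * blockSum x q v (n - v (Fin.last n)) else 0 := by
  induction q generalizing n with
  | zero => simp [total, blockSum]
  | succ q ih =>
    rw [show n + 1 + (q + 1) = n + 1 + 1 + q by ring,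
      ih (n + 1) fun i h1 h2 => hI i (by omega) (by omega), sum_perm_succ]
    refine Finset.sum_congr rfl fun v _ => ?_
    by_cases hv : IncreasingOn I v
    · rw [if_pos hv, blockSum, Finset.mul_sum]
      refine Finset.sum_congr rfl fun j _ => ?_
      have h1 : IncreasingOn I (insertLast v j) ↔ n + 1 - j ≤ n - (v (Fin.last n) : ℕ) := by
        have hlast : (v (Fin.last n) : ℕ) ≤ n := Nat.lt_succ_iff.1 (v (Fin.last n)).2
        have hj := j.2
        rw [increasingOn_insertLast]
        constructor
        · rintro ⟨-, h⟩
          have := h (Fin.last n) rfl (hI _ (by omega) (by omega))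
          omega
        · intro h
          refine ⟨hv, fun a ha _ => ?_⟩
          have : a = Fin.last n := Fin.ext (by simpa using ha)
          rw [this]
          omega
      rw [insertLast_last, mul_ite, mul_zero]
      refine if_ctx_congr h1 (fun h => ?_) fun _ => rfl
      rw [hφ]
      omega
    · rw [if_neg hv]
      refine Finset.sum_eq_zero fun j _ => if_neg fun h => hv ?_
      exact ((increasingOn_insertLast I v j).1 h).1

open Classical in
/-- The contribution of the permutations obtained from `v` by appending an increasing block. -/
theorem total_block (φ : ∀ n : ℕ, Equiv.Perm (Fin n) → K)
    (hφ : ∀ n (v : Equiv.Perm (Fin (n + 1))) (j : Fin (n + 1 + 1)), (j : ℕ) ≠ 0 →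
      φ (n + 1 + 1) (insertLast v j) = φ (n + 1) v)
    (hφ' : ∀ n (v : Equiv.Perm (Fin n)) i, SameParity v i → ∀ j,
      φ (n + 1) (insertLast (adjSwap n i * v) j) = φ (n + 1) (insertLast v j))
    (I : Finset ℕ) (q n : ℕ) (hn : n ∉ I) (hI : ∀ i, n < i → i ≤ n + q → i ∈ I) :
    total x φ I (n + 1 + q) = ∑ v : Equiv.Perm (Fin n) with Chessboard v,
      if IncreasingOn I v then weight x v * ∑ j : Fin (n + 1), φ (n + 1) (insertLast v j) *
        ((-1) ^ (n - j : ℕ) * x ^ countAbove v (n + 1) (n - j) *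
          chainSumOf x (countAbove v) (n + 1) q (n - j)) else 0 := by
  rw [total_append x φ hφ I q n hI, sum_perm_succ, ← sum_eq_sum_chessboard]
  · refine Finset.sum_congr rfl fun v _ => ?_
    by_cases hv : IncreasingOn I v
    · rw [if_pos hv, Finset.mul_sum]
      refine Finset.sum_congr rfl fun j _ => ?_
      rw [if_pos ((increasingOn_insertLast I v j).2 ⟨hv, fun _ _ h => absurd h hn⟩),
        insertLast_last, blockSum_eq x (countAbove v) q (n + 1) _ _ (by omega)
          fun p d hd => countAbove_insertLast v j p d hd, weight_insertLast]
      ring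
    · rw [if_neg hv]
      refine Finset.sum_eq_zero fun j _ => if_neg fun h => hv ?_
      exact ((increasingOn_insertLast I v j).1 h).1
  -- Every ingredient other than the weight is invariant under the exchange, so the summand over the
  -- prefix `v` is antisymmetric.
  · intro v i h
    have hc : countAbove (adjSwap n i * v) = countAbove v :=
      funext fun p => funext fun d => countAbove_adjSwap_mul h p d
    simp only [increasingOn_adjSwap_mul I h, weight_adjSwap_mul x h, hc, hφ' n v i h]
    split_ifs <;> simp

open Classical in
theorem total_eq_chessboard (φ : ∀ n : ℕ, Equiv.Perm (Fin n) → K) (I : Finset ℕ) (n : ℕ)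
    (hφ : ∀ (v : Equiv.Perm (Fin n)) i, SameParity v i → φ n (adjSwap n i * v) = φ n v) :
    total x φ I n = ∑ v : Equiv.Perm (Fin n) with Chessboard v,
      if IncreasingOn I v then φ n v * weight x v else 0 := by
  rw [total, sum_eq_sum_chessboard]
  intro v i h
  simp only [increasingOn_adjSwap_mul I h, weight_adjSwap_mul x h, hφ v i h]
  split_ifs <;> simp

/-- The indicator function of `ZeroEven`. -/
noncomputable def zeroEvenInd (n : ℕ) (v : Equiv.Perm (Fin n)) : K :=
  open Classical in if ZeroEven v then 1 else 0

/-- The generating function of the permutations that are increasing across `I`. -/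
noncomputable def fullTotal (I : Finset ℕ) (n : ℕ) : K := total x (fun _ _ => 1) I n

/-- The part of `fullTotal` with the value `0` in an even position. -/
noncomputable def evenTotal (I : Finset ℕ) (n : ℕ) : K := total x zeroEvenInd I n

theorem zeroEvenInd_adjSwap_mul {n : ℕ} {v : Equiv.Perm (Fin n)} {i : ℕ} (h : SameParity v i) :
    zeroEvenInd (K := K) n (adjSwap n i * v) = zeroEvenInd n v := by
  classical exact if_congr (zeroEven_adjSwap_mul h) rfl rfl

theorem zeroEvenInd_insertLast {n : ℕ} (v : Equiv.Perm (Fin n)) (j : Fin (n + 1)) :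
    zeroEvenInd (K := K) (n + 1) (insertLast v j) =
      if (j : ℕ) = 0 then (if n % 2 = 0 then 1 else 0) else zeroEvenInd n v := by
  have h := zeroEven_insertLast v j
  unfold zeroEvenInd
  split_ifs at h ⊢ <;> simp_all

open Classical in
theorem fullTotal_of_odd (I : Finset ℕ) {n : ℕ} (hn : n % 2 = 1) :
    fullTotal x I n = evenTotal x I n := by
  rw [fullTotal, evenTotal, total_eq_chessboard x (fun _ _ => 1) I n fun _ _ _ => rfl,
    total_eq_chessboard x _ I n fun _ _ h => zeroEvenInd_adjSwap_mul h]
  refine Finset.sum_congr rfl fun v hv => ?_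
  have h : ZeroEven v := by
    by_contra h0
    have := Chessboard.even_of_not_zeroEven (Finset.mem_filter.1 hv).2 h0
    omega
  simp [zeroEvenInd, h]

-- A quantity that on chessboard permutations depends only on `ZeroEven` leaves the sum as two
-- constants, so the two totals carry all the information from one block to the next.
open Classical in
theorem sum_chessboard_of_values (I : Finset ℕ) (n : ℕ) (g : Equiv.Perm (Fin n) → K) (a b : K)
    (ha : ∀ v, Chessboard v → ZeroEven v → g v = a)
    (hb : ∀ v, Chessboard v → ¬ ZeroEven v → g v = b) :
    (∑ v : Equiv.Perm (Fin n) with Chessboard v,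
        if IncreasingOn I v then weight x v * g v else 0) =
      evenTotal x I n * a + (fullTotal x I n - evenTotal x I n) * b := by
  rw [fullTotal, evenTotal, total_eq_chessboard x (fun _ _ => 1) I n fun _ _ _ => rfl,
    total_eq_chessboard x _ I n fun _ _ h => zeroEvenInd_adjSwap_mul h,
    ← Finset.sum_sub_distrib, Finset.sum_mul, Finset.sum_mul, ← Finset.sum_add_distrib]
  refine Finset.sum_congr rfl fun v hv => ?_
  have hc := (Finset.mem_filter.1 hv).2
  by_cases h : ZeroEven v
  · rw [ha v hc h]
    simp [zeroEvenInd, h]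
  · rw [hb v hc h]
    simp [zeroEvenInd, h]

theorem chainSumOf_countAbove_of_zeroEven {n : ℕ} {v : Equiv.Perm (Fin n)} (h : Chessboard v)
    (h0 : ZeroEven v) (q d : ℕ) (hd : d ≤ n) :
    x ^ countAbove v (n + 1) d * chainSumOf x (countAbove v) (n + 1) q d =
      x ^ ((d + 1) / 2) * chainSum x 0 q d := by
  rw [countAbove_of_zeroEven h h0 _ _ hd, if_pos rfl,
    chainSumOf_eq x (countAbove v) (n + 1) q d 0 (by omega)
      fun r d' hd' => countAbove_of_zeroEven h h0 r d' (hd'.trans hd)]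

theorem chainSumOf_countAbove_of_not_zeroEven {n : ℕ} {v : Equiv.Perm (Fin n)}
    (h : Chessboard v) (h0 : ¬ ZeroEven v) (q d : ℕ) (hd : d ≤ n) :
    x ^ countAbove v (n + 1) d * chainSumOf x (countAbove v) (n + 1) q d =
      x ^ (d / 2) * chainSum x 1 q d := by
  rw [countAbove_of_not_zeroEven h h0 _ _ hd, if_neg (by omega), add_zero,
    chainSumOf_eq x (countAbove v) (n + 1) q d 1 le_rfl fun r d' hd' => by
      rw [countAbove_of_not_zeroEven h h0 r d' (hd'.trans hd), show n + 1 + 1 = n + 2 by ring,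
        Nat.add_mod_right]]

theorem fullTotal_block (I : Finset ℕ) (q n : ℕ) (hn : n ∉ I)
    (hI : ∀ i, n < i → i ≤ n + q → i ∈ I) :
    fullTotal x I (n + 1 + q) = evenTotal x I n * chainSum x 1 (q + 1) n +
      (fullTotal x I n - evenTotal x I n) * chainSum x 0 (q + 1) n := by
  rw [fullTotal, total_block x (fun _ _ => 1) (fun _ _ _ _ => rfl) (fun _ _ _ _ _ => rfl) I q n
    hn hI]
  refine sum_chessboard_of_values x I n _ _ _ (fun v h h0 => ?_) fun v h h0 => ?_
  · rw [chainSum, ← sum_fin_reverse]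
    refine Finset.sum_congr rfl fun j _ => ?_
    rw [one_mul, mul_assoc, mul_assoc,
      chainSumOf_countAbove_of_zeroEven x h h0 _ _ (Nat.sub_le _ _)]
  · rw [chainSum, ← sum_fin_reverse]
    refine Finset.sum_congr rfl fun j _ => ?_
    rw [one_mul, mul_assoc, mul_assoc,
      chainSumOf_countAbove_of_not_zeroEven x h h0 _ _ (Nat.sub_le _ _)]
    rfl

/-- Only the choice `j = 0`, that is `d = n`, can change the status of the value `0`. For a prefix
with `0` in an even position it must be discarded when `n` is odd; for the other prefixes, which
exist only when `n` is even, it is the sole surviving choice. -/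
theorem evenTotal_block (I : Finset ℕ) (q n : ℕ) (hn : n ∉ I)
    (hI : ∀ i, n < i → i ≤ n + q → i ∈ I) (a b : K)
    (ha : ∑ d ∈ Finset.range (n + 1), (if d = n then (if n % 2 = 0 then 1 else 0) else 1) *
      ((-1) ^ d * x ^ ((d + 1) / 2) * chainSum x 0 q d) = a)
    (hb : n % 2 = 0 → x ^ (n / 2) * chainSum x 1 q n = b) :
    evenTotal x I (n + 1 + q) = evenTotal x I n * a +
      (fullTotal x I n - evenTotal x I n) * b := by
  rw [evenTotal, total_block x zeroEvenInd (fun n v j hj => ?_) (fun n v i h j => ?_) I q n hn hI]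
  · refine sum_chessboard_of_values x I n _ _ _ (fun v h h0 => ?_) fun v h h0 => ?_
    · rw [← ha, ← sum_fin_reverse]
      refine Finset.sum_congr rfl fun j _ => ?_
      rw [mul_assoc, chainSumOf_countAbove_of_zeroEven x h h0 _ _ (Nat.sub_le _ _), mul_assoc,
        zeroEvenInd_insertLast, zeroEvenInd, if_pos h0]
      congr 1
      have := j.2
      refine if_congr ?_ rfl rfl
      omega
    · have hn := h.even_of_not_zeroEven h0
      rw [Fin.sum_univ_succ, Finset.sum_eq_zero, add_zero]
      · rw [mul_assoc, chainSumOf_countAbove_of_not_zeroEven x h h0 _ _ (Nat.sub_le _ _),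
          zeroEvenInd_insertLast]
        simp [hn, hb hn, Even.neg_one_pow (Nat.even_iff.2 hn)]
      · intro j _
        rw [zeroEvenInd_insertLast, zeroEvenInd, if_neg h0]
        simp
  · rw [zeroEvenInd_insertLast, if_neg hj]
  · rw [zeroEvenInd_insertLast, zeroEvenInd_insertLast, zeroEvenInd_adjSwap_mul h]

theorem evenTotal_block_of_even (I : Finset ℕ) (q n : ℕ) (hn : n ∉ I)
    (hI : ∀ i, n < i → i ≤ n + q → i ∈ I) (heven : n % 2 = 0) :
    evenTotal x I (n + 1 + q) = evenTotal x I n * chainSum x 1 (q + 1) n +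
      (fullTotal x I n - evenTotal x I n) * (x ^ (n / 2) * chainSum x 1 q n) := by
  refine evenTotal_block x I q n hn hI _ _ ?_ fun _ => rfl
  rw [chainSum]
  simp [heven]

/-- Dropping the term `d = n` lowers the bound of the chain sum to `n - 1`. The second coefficient
is irrelevant for odd `n` and is taken to be `0`. -/
theorem evenTotal_block_of_odd (I : Finset ℕ) (q n : ℕ) (hn : n ∉ I)
    (hI : ∀ i, n < i → i ≤ n + q → i ∈ I) (hodd : n % 2 = 1) :
    evenTotal x I (n + 1 + q) = evenTotal x I n * chainSum x 1 (q + 1) (n - 1) := by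
  rw [evenTotal_block x I q n hn hI (chainSum x 1 (q + 1) (n - 1)) 0 ?_ (by omega), mul_zero,
    add_zero]
  rw [chainSum, Finset.sum_range_succ, if_pos rfl, if_neg (by omega), zero_mul, add_zero,
    Nat.sub_add_cancel (by omega)]
  refine Finset.sum_congr rfl fun d hd => ?_
  rw [Finset.mem_range] at hd
  rw [if_neg (by omega), one_mul]

end BlockSum

/-! ### Splitting off the last component of the index set -/

section Components

variable {I : Finset ℕ} {n q : ℕ}

theorem mem_components {I : Finset ℕ} {a b : ℕ} : (a, b) ∈ components I ↔
    (a ∈ I ∧ b ∈ I) ∧ a ≤ b ∧ (∀ i, a ≤ i → i ≤ b → i ∈ I) ∧ (∀ c ∈ I, c + 1 ≠ a) ∧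
      b + 1 ∉ I := by
  simp only [components, Finset.mem_filter, Finset.mem_product]
  refine and_congr_right fun _ => and_congr_right fun _ => and_congr_left fun _ => ?_
  simp [Finset.subset_iff]

theorem mem_components_of_block (hn : n ∉ I) (hI : ∀ i, n < i → i ≤ n + q → i ∈ I)
    (hle : ∀ i ∈ I, i ≤ n + q) (a b : ℕ) :
    (a, b) ∈ components I ↔
      (a, b) ∈ components (I.filter (· < n)) ∨ q ≠ 0 ∧ (a, b) = (n + 1, n + q) := by
  rw [mem_components, mem_components]
  simp only [Finset.mem_filter, Prod.mk.injEq]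
  constructor
  · rintro ⟨⟨ha, hb⟩, hab, hint, hc, hb'⟩
    have han : a ≠ n := fun h => hn (h ▸ ha)
    rcases lt_or_gt_of_ne han with h | h
    · left
      have hbn : b < n := by
        by_contra hbn
        exact hn (hint n h.le (not_lt.1 hbn))
      exact ⟨⟨⟨ha, h⟩, hb, hbn⟩, hab, fun i h1 h2 => ⟨hint i h1 h2, by omega⟩,
        fun c hc' => hc c hc'.1, fun h => hb' h.1⟩
    · right
      have h1 : a = n + 1 := by
        by_contra hne
        have := hle a ha
        exact hc (a - 1) (hI _ (by omega) (by omega)) (by omega)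
      have h2 : b = n + q := by
        by_contra hne
        have := hle b hb
        exact hb' (hI _ (by omega) (by omega))
      exact ⟨by omega, h1, h2⟩
  · rintro (⟨⟨⟨ha, han⟩, hb, hbn⟩, hab, hint, hc, hb'⟩ | ⟨hq, rfl, rfl⟩)
    · refine ⟨⟨ha, hb⟩, hab, fun i h1 h2 => (hint i h1 h2).1,
        fun c hc' h => hc c ⟨hc', by omega⟩ h, fun h => ?_⟩
      rcases Nat.lt_or_ge (b + 1) n with h1 | h1
      · exact hb' ⟨h, h1⟩
      · have : b + 1 = n := by omega
        exact hn (this ▸ h)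
    · refine ⟨⟨hI _ (by omega) (by omega), hI _ (by omega) le_rfl⟩, by omega,
        fun i h1 h2 => hI i (by omega) h2, fun c hc h => hn ?_, fun h => ?_⟩
      · have : c = n := by omega
        exact this ▸ hc
      · have := hle _ h
        omega

/-- A block of `q + 1` positions comes from a component of size `q`. For `q = 0` there is no
component, and `f 0 = 1` absorbs the missing factor. -/
theorem prod_components_of_block {M : Type*} [CommMonoid M] (f : ℕ → M) (hf : f 0 = 1)
    (hn : n ∉ I) (hI : ∀ i, n < i → i ≤ n + q → i ∈ I) (hle : ∀ i ∈ I, i ≤ n + q) :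
    ∏ p ∈ components I, f (halfSize p) =
      (∏ p ∈ components (I.filter (· < n)), f (halfSize p)) * f ((q + 1) / 2) := by
  have hmem := mem_components_of_block hn hI hle
  by_cases hq : q = 0
  · have : components I = components (I.filter (· < n)) := by
      ext ⟨a, b⟩
      simp [hmem, hq]
    rw [this, hq, show (0 + 1) / 2 = 0 from rfl, hf, mul_one]
  · have h1 : components I = insert (n + 1, n + q) (components (I.filter (· < n))) := by
      ext ⟨a, b⟩
      rw [hmem, Finset.mem_insert]
      tauto
    have h2 : (n + 1, n + q) ∉ components (I.filter (· < n)) := by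
      rw [mem_components]
      simp
    rw [h1, Finset.prod_insert h2, mul_comm]
    congr 2
    simp only [halfSize, Nat.card_Icc]
    congr 1
    omega

theorem mI_of_block (hn : n ∉ I) (hI : ∀ i, n < i → i ≤ n + q → i ∈ I)
    (hle : ∀ i ∈ I, i ≤ n + q) : mI I = mI (I.filter (· < n)) + (q + 1) / 2 := by
  have := prod_components_of_block (M := Multiplicative ℕ) (fun k => Multiplicative.ofAdd k) rfl
    hn hI hle
  rw [← ofAdd_sum, ← ofAdd_sum, ← ofAdd_add] at this
  exact Multiplicative.ofAdd.injective this

/-- The block containing the last position. -/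
theorem exists_last_block {N : ℕ} (hI : I ⊆ Finset.Icc 1 N) :
    ∃ n q, n + q = N ∧ n ∉ I ∧ ∀ i, n < i → i ≤ n + q → i ∈ I := by
  classical
  have h0 : 0 ∉ I := fun h => by
    have := Finset.mem_Icc.1 (hI h)
    omega
  have h := Nat.findGreatest_spec (P := fun n => n ∉ I) (Nat.zero_le N) h0
  have hle := Nat.findGreatest_le (P := fun n => n ∉ I) N
  -- Cut at the greatest `n ≤ N` outside `I`; it exists because `0 ∉ I`.
  refine ⟨_, N - Nat.findGreatest (fun n => n ∉ I) N, by omega, h, fun i h1 h2 => ?_⟩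
  by_contra hi
  exact Nat.findGreatest_is_greatest h1 (by omega) hi

end Components

/-! ### Evaluation of the type A factor -/

section Total

variable {K : Type*} [Field K] {x : K}

theorem increasingOn_filter_lt (I : Finset ℕ) {n : ℕ} (v : Equiv.Perm (Fin n)) :
    IncreasingOn (I.filter (· < n)) v ↔ IncreasingOn I v := by
  refine forall_congr' fun a => forall_congr' fun b => forall_congr' fun _ => ?_
  simp

theorem total_filter_lt (φ : ∀ n : ℕ, Equiv.Perm (Fin n) → K) (I : Finset ℕ) (n : ℕ) :
    total x φ (I.filter (· < n)) n = total x φ I n := by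
  classical exact Finset.sum_congr rfl fun v _ => if_congr (increasingOn_filter_lt I v) rfl rfl

theorem total_zero (φ : ∀ n : ℕ, Equiv.Perm (Fin n) → K) (I : Finset ℕ) (v : Equiv.Perm (Fin 0)) :
    total x φ I 0 = φ 0 v := by
  have h : ∀ v : Equiv.Perm (Fin 0), IncreasingOn I v := fun v a => a.elim0
  rw [total, Fintype.sum_eq_single v fun w hw => absurd (Subsingleton.elim w v) hw, if_pos (h v)]
  simp [weight, inv, oddInv, pairCount]

variable (x) in
/-- The product of the `q`-Pochhammer symbols of the half sizes of the components. -/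
def compProd (I : Finset ℕ) : K := ∏ p ∈ components I, qPoch x (halfSize p)

variable (x) in
/-- The values of the two generating functions. -/
structure TotalSpec (I : Finset ℕ) (n : ℕ) : Prop where
  le : 2 * mI I ≤ n
  odd : ∀ r, n = 2 * r + 1 → evenTotal x I n = qPoch x r / compProd x I
  -- A component of size `c` gives a block of `c + 1` positions, so equality means that every block
  -- has even length.
  tight : n = 2 * mI I →
    evenTotal x I n = qPoch x (mI I) / compProd x I ∧ fullTotal x I n = evenTotal x I n
  even : ∀ e, n = 2 * (e + 1) → mI I ≤ e →
    evenTotal x I n = qPoch x e / compProd x I ∧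
      fullTotal x I n = (1 - x ^ (e + 1)) * evenTotal x I n

theorem gaussBinom_mul_qPoch (hm : ∀ i : ℕ, 1 - x ^ (i + 1) ≠ 0) (e k : ℕ) :
    qPoch x e * gaussBinom x e k = qPoch x (e + k) / qPoch x k := by
  have h1 := qPoch_ne_zero hm e
  rw [gaussBinom]
  field_simp

/-- The Pascal rule at `q = x²`, needed for `evenTotal` when a block of even length follows a
non-tight prefix of even degree; the power `x ^ (2 * (e + 1))` joins the block coefficient `x ^ (e +
1)` to the defect of `fullTotal`. -/
theorem gaussBinom_pascal (hm : ∀ i : ℕ, 1 - x ^ (i + 1) ≠ 0) (e k : ℕ) :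
    gaussBinom x (e + 1) (k + 1) - x ^ (2 * (e + 1)) * gaussBinom x (e + 1) k =
      gaussBinom x e (k + 1) := by
  have h1 : 1 - x ^ (2 * (e + 1)) ≠ 0 := hm (2 * e + 1)
  have h2 : 1 - x ^ (2 * (k + 1)) ≠ 0 := hm (2 * k + 1)
  rw [gaussBinom_succ_left hm, gaussBinom_succ_left hm, gaussBinom_succ_right hm]
  field_simp
  ring

/-- The companion identity for `fullTotal` in the same case; the numerator acquires a factor `1 + x
^ (e + 1 + k)`, which cancels the denominator. -/
theorem gaussBinom_succ_sub (hm : ∀ i : ℕ, 1 - x ^ (i + 1) ≠ 0) (hp : ∀ i : ℕ, 1 + x ^ i ≠ 0)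
    (e k : ℕ) : gaussBinom x (e + 1) k - x ^ (e + 1) *
      (gaussBinom x (e + 1) k * (x ^ (e + 1) + x ^ k) / (1 + x ^ (e + 1 + k))) =
      (1 - x ^ (e + 1 + k)) * gaussBinom x e k := by
  have h1 : 1 - x ^ (2 * (e + 1)) ≠ 0 := hm (2 * e + 1)
  have h2 := hp (e + 1 + k)
  rw [gaussBinom_succ_left hm]
  field_simp
  ring

/-- One case for each parity of `n` and of the block length, with even `n` split again into tight
and not. Odd and tight prefixes have `fullTotal = evenTotal`, so one coefficient suffices; otherwise
the difference is `-x ^ (e + 1)` times `evenTotal`. Each block multiplies `evenTotal` by a Gaussian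
binomial, and `gaussBinom_mul_qPoch` telescopes the product. -/
theorem totalSpec_block (hm : ∀ i : ℕ, 1 - x ^ (i + 1) ≠ 0) (hp : ∀ i : ℕ, 1 + x ^ i ≠ 0)
    {I : Finset ℕ} {n q : ℕ} (hn : n ∉ I) (hI : ∀ i, n < i → i ≤ n + q → i ∈ I)
    (hle : ∀ i ∈ I, i ≤ n + q) (h : TotalSpec x (I.filter (· < n)) n) :
    TotalSpec x I (n + 1 + q) := by
  obtain ⟨h1, h2, h3, h4⟩ := h
  have hmI := mI_of_block hn hI hle
  have hcp : compProd x I = compProd x (I.filter (· < n)) * qPoch x ((q + 1) / 2) :=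
    prod_components_of_block (qPoch x) (qPoch_zero x) hn hI hle
  have hT : fullTotal x (I.filter (· < n)) n = fullTotal x I n := total_filter_lt _ I n
  have hE : evenTotal x (I.filter (· < n)) n = evenTotal x I n := total_filter_lt _ I n
  rw [hE] at h2 h3 h4
  rw [hT] at h3 h4
  have hfb := fullTotal_block x I q n hn hI
  set m := mI (I.filter (· < n))
  set D := compProd x (I.filter (· < n))
  have hparity : ∃ e, n = 2 * e ∨ n = 2 * e + 1 := ⟨n / 2, by omega⟩
  have hparity' : ∃ k, q + 1 = 2 * k + 1 ∨ q + 1 = 2 * (k + 1) := ⟨q / 2, by omega⟩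
  obtain ⟨k, hk⟩ := hparity'
  have hg := gaussBinom_mul_qPoch hm
  obtain ⟨e, rfl | rfl⟩ := hparity
  · have heb := evenTotal_block_of_even x I q (2 * e) hn hI (by omega)
    rw [show 2 * e / 2 = e by omega] at heb
    have hcases : e = m ∨ ∃ e', e = e' + 1 ∧ m ≤ e' := by
      rcases Nat.lt_or_ge m e with h | h
      · exact Or.inr ⟨e - 1, by omega, by omega⟩
      · exact Or.inl (by omega)
    rcases hk with hk | hk
    · have hq : q = 2 * k := by omega
      subst hq
      rw [(chainSum_odd hm hp k e).1.1, (chainSum_even hm hp k e).1.1] at heb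
      rw [show (2 * k + 1) / 2 = k by omega] at hmI hcp
      refine ⟨by omega, fun r hr => ?_, fun ht => by omega, fun e' he' => by omega⟩
      obtain rfl : r = e + k := by omega
      rw [heb, hcp, mul_comm D, ← div_div, ← hg]
      rcases hcases with he | ⟨e', rfl, he'⟩
      · obtain ⟨h5, h6⟩ := h3 (by omega)
        rw [h6, h5, ← he]
        ring
      · obtain ⟨h5, h6⟩ := h4 e' rfl he'
        rw [h6, h5, qPoch_succ]
        ring
    · have hq : q = 2 * k + 1 := by omega
      subst hq
      rw [show 2 * k + 1 + 1 = 2 * (k + 1) by ring] at heb hfb hcp hmI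
      rw [(chainSum_even hm hp (k + 1) e).1.1, (chainSum_odd hm hp k e).1.1] at heb
      rw [(chainSum_even hm hp (k + 1) e).1.1, (chainSum_even hm hp (k + 1) e).2.1] at hfb
      rw [show 2 * (k + 1) / 2 = k + 1 by omega] at hmI hcp
      rcases hcases with he | ⟨e', rfl, he'⟩
      · refine ⟨by omega, fun r hr => by omega, fun _ => ?_, fun e' he' => by omega⟩
        obtain ⟨h5, h6⟩ := h3 (by omega)
        rw [hfb, heb, h6, hcp, mul_comm D, ← div_div, hmI, ← hg, h5, he]
        constructor <;> ring
      · refine ⟨by omega, fun r hr => by omega, fun _ => by omega, fun e'' he'' _ => ?_⟩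
        obtain ⟨h5, h6⟩ := h4 e' rfl he'
        obtain rfl : e'' = e' + (k + 1) := by omega
        have hE' : evenTotal x I (2 * (e' + 1) + 1 + (2 * k + 1)) =
            evenTotal x I (2 * (e' + 1)) * gaussBinom x e' (k + 1) := by
          rw [heb, h6]
          linear_combination (evenTotal x I (2 * (e' + 1))) * gaussBinom_pascal hm e' k
        constructor
        · rw [hE', h5, hcp, mul_comm D, ← div_div, ← hg]
          ring
        · rw [hE', hfb, h6, show e' + (k + 1) + 1 = e' + 1 + (k + 1) by ring]
          linear_combination (evenTotal x I (2 * (e' + 1))) * gaussBinom_succ_sub hm hp e' (k + 1)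
  · have heb := evenTotal_block_of_odd x I q (2 * e + 1) hn hI (by omega)
    rw [Nat.add_sub_cancel] at heb
    rw [fullTotal_of_odd x I (n := 2 * e + 1) (by omega), sub_self, zero_mul, add_zero] at hfb
    have hα := h2 e rfl
    rcases hk with hk | hk
    · have hq : q = 2 * k := by omega
      subst hq
      rw [(chainSum_odd hm hp k e).1.1] at heb
      rw [(chainSum_odd hm hp k e).1.2] at hfb
      rw [show (2 * k + 1) / 2 = k by omega] at hmI hcp
      refine ⟨by omega, fun r hr => by omega, fun ht => by omega, fun e' he' _ => ?_⟩
      obtain rfl : e' = e + k := by omega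
      rw [hfb, heb, hcp, mul_comm D, ← div_div, ← hg, hα]
      constructor <;> ring
    · have hq : q = 2 * k + 1 := by omega
      subst hq
      rw [show 2 * k + 1 + 1 = 2 * (k + 1) by ring] at heb hcp hmI
      rw [(chainSum_even hm hp (k + 1) e).1.1] at heb
      rw [show 2 * (k + 1) / 2 = k + 1 by omega] at hmI hcp
      refine ⟨by omega, fun r hr => ?_, fun ht => by omega, fun e' he' => by omega⟩
      obtain rfl : r = e + (k + 1) := by omega
      rw [heb, hcp, mul_comm D, ← div_div, ← hg, hα]
      ring

theorem totalSpec (hm : ∀ i : ℕ, 1 - x ^ (i + 1) ≠ 0) (hp : ∀ i : ℕ, 1 + x ^ i ≠ 0)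
    (n : ℕ) (I : Finset ℕ) (hI : I ⊆ Finset.Icc 1 (n - 1)) : TotalSpec x I n := by
  induction n using Nat.strong_induction_on generalizing I with
  | _ n ih =>
    rcases n with _ | N
    · have hI' : I = ∅ := by
        simpa using hI
      subst hI'
      have hc : components ∅ = ∅ := rfl
      have hm0 : mI ∅ = 0 := rfl
      have hE : evenTotal x ∅ 0 = 1 := by
        rw [evenTotal, total_zero _ _ 1, zeroEvenInd, if_pos (show ZeroEven 1 from fun p => p.elim0)]
      have hF : fullTotal x ∅ 0 = 1 := total_zero _ _ 1
      refine ⟨by simp [hm0], fun r hr => by omega, fun _ => ?_, fun e he => by omega⟩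
      rw [hE, hF, hm0, compProd, hc]
      simp [qPoch]
    · obtain ⟨n, q, hN, hn, hblock⟩ := exists_last_block hI
      have h := totalSpec_block hm hp hn hblock
        (fun i hi => by have := Finset.mem_Icc.1 (hI hi); omega) (ih n (by omega) _ ?_)
      · rwa [show n + 1 + q = N + 1 by omega] at h
      · intro i hi
        rw [Finset.mem_filter] at hi
        have := Finset.mem_Icc.1 (hI hi.1)
        rw [Finset.mem_Icc]
        omega

variable (x) in
/-- The product on the right-hand side with lower limit `a` and upper limit `n`. -/
def signedProd (a n : ℕ) : K := ∏ i ∈ Finset.Icc a n, (1 + (-1) ^ (i - 1) * x ^ (i / 2))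

theorem signedProd_succ {a n : ℕ} (h : a ≤ n + 1) :
    signedProd x a (n + 1) = signedProd x a n * (1 + (-1) ^ n * x ^ ((n + 1) / 2)) := by
  rw [signedProd, Finset.prod_Icc_succ_top h, Nat.add_sub_cancel, signedProd]

/-- The factors with indices `2r` and `2r + 1` are `1 - x ^ r` and `1 + x ^ r`, with product `1 - x
^ (2 * r)`. -/
theorem signedProd_odd (m t : ℕ) :
    qPoch x m * signedProd x (2 * m + 2) (2 * (m + t) + 1) = qPoch x (m + t) := by
  induction t with
  | zero =>
    rw [signedProd, Finset.Icc_eq_empty (by omega)]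
    simp
  | succ t ih =>
    rw [show 2 * (m + (t + 1)) + 1 = 2 * (m + t) + 1 + 1 + 1 by ring,
      signedProd_succ (by omega), signedProd_succ (by omega), ← mul_assoc, ← mul_assoc, ih,
      show m + (t + 1) = m + t + 1 by ring, qPoch_succ, Odd.neg_one_pow ⟨m + t, rfl⟩,
      Even.neg_one_pow ⟨m + t + 1, by ring⟩, show (2 * (m + t) + 1 + 1) / 2 = m + t + 1 by omega,
      show (2 * (m + t) + 1 + 1 + 1) / 2 = m + t + 1 by omega]
    ring

theorem fullTotal_eq (hm : ∀ i : ℕ, 1 - x ^ (i + 1) ≠ 0) (hp : ∀ i : ℕ, 1 + x ^ i ≠ 0)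
    (n : ℕ) (I : Finset ℕ) (hI : I ⊆ Finset.Icc 1 (n - 1)) :
    fullTotal x I n =
      qPoch x (mI I) / compProd x I * signedProd x (2 * mI I + 2) n := by
  obtain ⟨h1, h2, h3, h4⟩ := totalSpec hm hp n I hI
  have hparity : ∃ e, n = 2 * e + 1 ∨ n = 2 * e := ⟨n / 2, by omega⟩
  obtain ⟨e, rfl | rfl⟩ := hparity
  · obtain ⟨t, rfl⟩ := Nat.exists_eq_add_of_le (show mI I ≤ e by omega)
    rw [fullTotal_of_odd x I (by omega), h2 _ rfl, ← signedProd_odd]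
    ring
  · rcases Nat.lt_or_ge (mI I) e with h | h
    · obtain ⟨t, rfl⟩ := Nat.exists_eq_add_of_lt h
      obtain ⟨h5, h6⟩ := h4 (mI I + t) (by ring) (by omega)
      rw [h6, h5, show 2 * (mI I + t + 1) = 2 * (mI I + t) + 1 + 1 by ring,
        signedProd_succ (by omega), ← signedProd_odd, Odd.neg_one_pow ⟨mI I + t, rfl⟩,
        show (2 * (mI I + t) + 1 + 1) / 2 = mI I + t + 1 by omega]
      ring
    · obtain ⟨h5, h6⟩ := h3 (by omega)
      rw [h6, h5, signedProd, Finset.Icc_eq_empty (by omega), Finset.prod_empty, mul_one]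

theorem qFactorial_sq (k : ℕ) : qFactorial (x ^ 2) k = qPoch x k / (1 - x ^ 2) ^ k := by
  rw [qFactorial, qPoch]
  simp only [qNum, ← pow_mul]
  rw [Finset.prod_div_distrib]
  simp

/-- The half sizes add up to `mI I`, so the powers of `1 - x ^ 2` in numerator and denominator
cancel. -/
theorem qMultinomial_eq (hm : ∀ i : ℕ, 1 - x ^ (i + 1) ≠ 0) (I : Finset ℕ) :
    qFactorial (x ^ 2) (mI I) / ∏ p ∈ components I, qFactorial (x ^ 2) (halfSize p) =
      qPoch x (mI I) / compProd x I := by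
  have h1 := hm 1
  simp only [qFactorial_sq, Finset.prod_div_distrib, Finset.prod_pow_eq_pow_sum]
  rw [← mI, ← compProd, div_div_div_cancel_right₀ (pow_ne_zero _ h1)]

end Total

/-! ### Increasing signed words and the factor of the signs -/

section SignedWord

/-- The increasing word with entries `±1, …, ±n` whose entry of absolute value `k + 1` is negative
if and only if `ε k`. -/
def signedWord : (n : ℕ) → (Fin n → Bool) → Fin n → ℤ
  | 0, _ => fun _ => 0
  | n + 1, ε =>
    if ε (Fin.last n) then Fin.cons (-((n : ℤ) + 1)) (signedWord n (Fin.init ε))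
    else Fin.snoc (signedWord n (Fin.init ε)) ((n : ℤ) + 1)

variable {n : ℕ}

theorem signedWord_snoc_true (ε : Fin n → Bool) :
    signedWord (n + 1) (Fin.snoc ε true) = Fin.cons (-((n : ℤ) + 1)) (signedWord n ε) := by
  simp [signedWord]

theorem signedWord_snoc_false (ε : Fin n → Bool) :
    signedWord (n + 1) (Fin.snoc ε false) = Fin.snoc (signedWord n ε) ((n : ℤ) + 1) := by
  simp [signedWord]

theorem mem_range_signedWord (ε : Fin n → Bool) (z : ℤ) :
    (∃ k, signedWord n ε k = z) ↔ ∃ k : Fin n, z = if ε k then -((k : ℤ) + 1) else (k : ℤ) + 1 := by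
  induction n with
  | zero => simp
  | succ n ih =>
    induction ε using Fin.snocCases with
    | snoc ε b =>
      cases b
      · rw [signedWord_snoc_false, Fin.exists_fin_succ', Fin.exists_fin_succ']
        simp [ih, @eq_comm _ z]
      · rw [signedWord_snoc_true, Fin.exists_fin_succ, Fin.exists_fin_succ']
        simp [ih, @eq_comm _ z, or_comm]

theorem signedWord_bounds (ε : Fin n → Bool) (k : Fin n) :
    -(n : ℤ) ≤ signedWord n ε k ∧ signedWord n ε k ≤ n ∧ signedWord n ε k ≠ 0 := by
  obtain ⟨l, hl⟩ := (mem_range_signedWord ε _).1 ⟨k, rfl⟩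
  have := l.2
  split_ifs at hl <;> omega

theorem signedWord_strictMono (ε : Fin n → Bool) : StrictMono (signedWord n ε) := by
  induction n with
  | zero => intro a
            exact a.elim0
  | succ n ih =>
    induction ε using Fin.snocCases with
    | snoc ε b =>
      cases b
      · rw [signedWord_snoc_false]
        intro a b hab
        induction b using Fin.lastCases with
        | last =>
          induction a using Fin.lastCases with
          | last => exact absurd hab (lt_irrefl _)
          | cast a =>
            have := signedWord_bounds ε a
            rw [Fin.snoc_castSucc, Fin.snoc_last]
            omega
        | cast b =>
          induction a using Fin.lastCases with
          | last => exact absurd hab (Fin.le_last _).not_gt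
          | cast a =>
            rw [Fin.snoc_castSucc, Fin.snoc_castSucc]
            exact ih ε (by simpa using hab)
      · rw [signedWord_snoc_true]
        intro a b hab
        induction a using Fin.cases with
        | zero =>
          induction b using Fin.cases with
          | zero => exact absurd hab (lt_irrefl _)
          | succ b =>
            have := signedWord_bounds ε b
            rw [Fin.cons_zero, Fin.cons_succ]
            omega
        | succ a =>
          induction b using Fin.cases with
          | zero => exact absurd hab (Fin.zero_le _).not_gt
          | succ b =>
            rw [Fin.cons_succ, Fin.cons_succ]
            exact ih ε (by simpa using hab)

theorem signedWord_abs_injective (ε : Fin n → Bool) {a b : Fin n}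
    (h : signedWord n ε a = -signedWord n ε b) : False := by
  obtain ⟨k, hk⟩ := (mem_range_signedWord ε _).1 ⟨a, rfl⟩
  obtain ⟨l, hl⟩ := (mem_range_signedWord ε _).1 ⟨b, rfl⟩
  have hkl : k = l := Fin.ext (by split_ifs at hk hl <;> omega)
  subst hkl
  split_ifs at hk hl <;> omega

/-- The number of negative entries. -/
def negCount (f : Fin n → ℤ) : ℕ := (Finset.univ.filter fun k => f k < 0).card

/-- The number of pairs of positions whose index sum satisfies `Q` and whose entries have a
negative sum. -/
noncomputable def negPairs (Q : ℕ → Prop) (f : Fin n → ℤ) : ℕ :=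
  pairCount Q (fun a b => a + b < 0) f

theorem negCount_signedWord_snoc (ε : Fin n → Bool) (b : Bool) :
    negCount (signedWord (n + 1) (Fin.snoc ε b)) =
      negCount (signedWord n ε) + if b then 1 else 0 := by
  cases b
  · rw [signedWord_snoc_false, negCount, Finset.card_filter, Fin.sum_univ_castSucc, negCount,
      Finset.card_filter]
    have : ¬ ((n : ℤ) + 1 < 0) := by omega
    simp [this]
  · rw [signedWord_snoc_true, negCount, Finset.card_filter, Fin.sum_univ_succ, negCount,
      Finset.card_filter]
    have : -((n : ℤ) + 1) < 0 := by omega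
    simp only [Fin.cons_zero, Fin.cons_succ, if_pos this]
    rw [add_comm]
    rfl

theorem negPairs_signedWord_snoc_false (Q : ℕ → Prop) (ε : Fin n → Bool) :
    negPairs Q (signedWord (n + 1) (Fin.snoc ε false)) = negPairs Q (signedWord n ε) := by
  classical
  rw [signedWord_snoc_false, negPairs, pairCount_succ_last, Finset.card_eq_zero.2, add_zero]
  · simp [negPairs]
  · refine Finset.eq_empty_of_forall_notMem fun k h => ?_
    have := signedWord_bounds ε k
    simp only [Finset.mem_filter, Fin.snoc_castSucc, Fin.snoc_last] at h
    omega

-- The new first entry `-(n + 1)` outweighs every other entry, so all pairs containing it have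
-- negative sum.
open Classical in
theorem negPairs_signedWord_snoc_true {Q : ℕ → Prop} (hQ : ∀ m, Q (m + 2) ↔ Q m)
    (ε : Fin n → Bool) :
    negPairs Q (signedWord (n + 1) (Fin.snoc ε true)) = negPairs Q (signedWord n ε) +
      (Finset.univ.filter fun i : Fin n => Q (i + 1)).card := by
  rw [signedWord_snoc_true, negPairs, pairCount_succ_first hQ]
  simp only [Fin.cons_succ, Fin.cons_zero]
  congr 2
  ext k
  have := signedWord_bounds ε k
  simp only [Finset.mem_filter, Finset.mem_univ, true_and, and_iff_left_iff_imp]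
  intro _
  omega

theorem card_filter_odd_succ (n : ℕ) :
    (Finset.univ.filter fun i : Fin n => Odd ((i : ℕ) + 1)).card = (n + 1) / 2 := by
  rw [Finset.card_filter, Fin.sum_univ_eq_sum_range (fun i => if Odd (i + 1) then 1 else 0)]
  induction n with
  | zero => simp
  | succ n ih =>
    rw [Finset.sum_range_succ, ih]
    simp only [Nat.odd_iff]
    split_ifs <;> omega

variable {K : Type*} [Field K] (x : K)

/-- The contribution of the pairs with negative sum to the generating function. -/
noncomputable def negWeight (f : Fin n → ℤ) : K :=
  (-1) ^ negPairs (fun _ => True) f * x ^ negPairs Odd f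

theorem negWeight_signedWord_snoc (ε : Fin n → Bool) (b : Bool) :
    negWeight x (signedWord (n + 1) (Fin.snoc ε b)) = negWeight x (signedWord n ε) *
      if b then (-1) ^ n * x ^ ((n + 1) / 2) else 1 := by
  classical
  cases b
  · rw [negWeight, negPairs_signedWord_snoc_false, negPairs_signedWord_snoc_false]
    simp [negWeight]
  · rw [negWeight, negPairs_signedWord_snoc_true fun _ => Iff.rfl,
      negPairs_signedWord_snoc_true fun m => by rw [Nat.odd_add]; simp]
    have h := card_filter_odd_succ n
    rw [if_pos rfl, negWeight, ← h]
    simp only [Finset.filter_true, Finset.card_univ, Fintype.card_fin]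
    ring_nf

theorem sum_snoc {M : Type*} [AddCommMonoid M] (F : (Fin (n + 1) → Bool) → M) :
    ∑ ε, F ε = ∑ ε : Fin n → Bool, F (Fin.snoc ε false) + ∑ ε : Fin n → Bool, F (Fin.snoc ε true) := by
  rw [← Equiv.sum_comp (Fin.snocEquiv fun _ : Fin (n + 1) => Bool), Fintype.sum_prod_type,
    Fintype.sum_bool, add_comm]
  rfl

/-- The generating function of the increasing words with an even or odd number of negative
entries, according to `r`. -/
noncomputable def signTotal (n r : ℕ) : K :=
  ∑ ε : Fin n → Bool, if negCount (signedWord n ε) % 2 = r then negWeight x (signedWord n ε) else 0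

theorem signTotal_succ (n r : ℕ) (hr : r ≤ 1) :
    signTotal x (n + 1) r =
      signTotal x n r + (-1) ^ n * x ^ ((n + 1) / 2) * signTotal x n (1 - r) := by
  rw [signTotal, sum_snoc, signTotal, signTotal, Finset.mul_sum]
  congr 1
  · refine Finset.sum_congr rfl fun ε _ => ?_
    simp [negCount_signedWord_snoc, negWeight_signedWord_snoc]
  · refine Finset.sum_congr rfl fun ε _ => ?_
    rw [negCount_signedWord_snoc, negWeight_signedWord_snoc, if_pos rfl, if_pos rfl, mul_ite,
      mul_zero, mul_comm]
    refine if_congr ?_ rfl rfl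
    omega

/-- The entry `±1` contributes the factor `1` for either sign, so the even and odd totals agree from
degree one on; the recursion then multiplies both by the same factor. -/
theorem signTotal_eq (n : ℕ) : signTotal x (n + 1) 0 = signedProd x 2 (n + 1) ∧
    signTotal x (n + 1) 1 = signedProd x 2 (n + 1) := by
  induction n with
  | zero =>
    rw [signTotal_succ x 0 0 (by omega), signTotal_succ x 0 1 le_rfl, signedProd,
      Finset.Icc_eq_empty (by omega)]
    simp [signTotal, negCount, negWeight, negPairs, pairCount]
  | succ n ih =>
    rw [signTotal_succ x (n + 1) 0 (by omega), signTotal_succ x (n + 1) 1 le_rfl,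
      show 1 - 0 = 1 from rfl, show 1 - 1 = 0 from rfl, ih.1, ih.2,
      signedProd_succ (a := 2) (n := n + 1) (by omega)]
    constructor <;> ring

theorem signTotal_zero (n : ℕ) : signTotal x n 0 = signedProd x 2 n := by
  rcases n with _ | n
  · simp [signTotal, negCount, negWeight, negPairs, pairCount, signedProd]
  · exact (signTotal_eq x n).1

open Classical in
/-- The sum over all signed words with a given set of entries. -/
theorem sum_comp_strictMono {u : Fin n → ℤ} (hu : StrictMono u) (I : Finset ℕ) :
    (∑ v : Equiv.Perm (Fin n), if IncreasingOn I v then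
      (-1) ^ (inv (u ∘ v) + negPairs (fun _ => True) (u ∘ v)) *
        x ^ (oddInv (u ∘ v) + negPairs Odd (u ∘ v)) else 0) =
      negWeight x u * fullTotal x I n := by
  have hsymm : ∀ a b : ℤ, a + b < 0 ↔ b + a < 0 := fun a b => by rw [add_comm]
  have h1 : ∀ v : Equiv.Perm (Fin n),
      (-1) ^ (inv (u ∘ v) + negPairs (fun _ => True) (u ∘ v)) *
        x ^ (oddInv (u ∘ v) + negPairs Odd (u ∘ v)) =
      (-1) ^ negPairs (fun _ => True) u * (weight x v * x ^ negPairs Odd (u ∘ v)) := by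
    intro v
    have h2 : inv (u ∘ v) = inv v := pairCount_comp_strictMono _ _ hu
    have h3 : oddInv (u ∘ v) = oddInv v := pairCount_comp_strictMono _ _ hu
    have h4 : negPairs (fun _ => True) (u ∘ v) = negPairs (fun _ => True) u :=
      pairCount_comp_perm hsymm u v fun _ _ => Iff.rfl
    rw [h2, h3, h4, weight]
    ring
  simp_rw [h1]
  -- The odd negative pairs of `u ∘ v` depend on `v` in general, so the cancellation must come
  -- before `negWeight x u` can be pulled out.
  rw [sum_eq_sum_chessboard, fullTotal, total_eq_chessboard x (fun _ _ => 1) I n fun _ _ _ => rfl,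
    Finset.mul_sum]
  · refine Finset.sum_congr rfl fun v hv => ?_
    have h5 : negPairs Odd (u ∘ v) = negPairs Odd u :=
      pairCount_comp_perm hsymm u v (Finset.mem_filter.1 hv).2.odd_add
    rw [h5, negWeight]
    split_ifs <;> ring
  · intro v i h
    obtain ⟨σ, h6, h7⟩ := exists_comp_of_sameParity h
    have h8 : negPairs Odd (u ∘ ⇑(adjSwap n i * v)) = negPairs Odd (u ∘ v) := by
      rw [h6, Equiv.Perm.coe_mul, ← Function.comp_assoc]
      refine pairCount_comp_perm hsymm (u ∘ v) σ fun a b => ?_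
      rw [Nat.odd_iff, Nat.odd_iff, Nat.add_mod, h7, h7, ← Nat.add_mod]
    rw [h8, weight_adjSwap_mul x h]
    simp only [increasingOn_adjSwap_mul I h]
    split_ifs <;> simp

end SignedWord

/-! ### Positive roots and heights in coordinates -/

section Roots

variable {n : ℕ}

/-- The standard basis vector of index `k`. -/
def basisVec (k : Fin n) : Fin n → ℤ := Pi.single k 1

theorem basisVec_apply (k j : Fin n) : basisVec k j = if j = k then 1 else 0 := by
  rw [basisVec, Pi.single_apply]

theorem e_succ (k : Fin n) : e n ((k : ℤ) + 1) = basisVec k := by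
  ext j
  simp only [e, basisVec_apply, Fin.ext_iff]
  split_ifs <;> omega

theorem e_neg (a : ℤ) : e n (-a) = -e n a := by
  ext j
  simp only [e, Pi.neg_apply]
  split_ifs <;> omega

theorem e_one (h : 0 < n) : e n 1 = basisVec ⟨0, h⟩ := by
  rw [← e_succ]
  simp

theorem e_two (h : 1 < n) : e n 2 = basisVec ⟨1, h⟩ := by
  rw [← e_succ]
  norm_num

/-- The linear form taking the value `1` on every simple root. -/
def heightForm (v : Fin n → ℤ) : ℤ := ∑ j : Fin n, (j : ℤ) * v j

theorem heightForm_basisVec (k : Fin n) : heightForm (basisVec k) = k := by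
  simp [heightForm, basisVec_apply]

theorem heightForm_add (u v : Fin n → ℤ) : heightForm (u + v) = heightForm u + heightForm v := by
  simp [heightForm, mul_add, Finset.sum_add_distrib]

theorem heightForm_neg (v : Fin n → ℤ) : heightForm (-v) = -heightForm v := by
  simp [heightForm]

theorem heightForm_sub (u v : Fin n → ℤ) : heightForm (u - v) = heightForm u - heightForm v := by
  rw [sub_eq_add_neg, heightForm_add, heightForm_neg, sub_eq_add_neg]

theorem simpleRoot_of_pos {i k : Fin n} (h : (k : ℕ) + 1 = i) :
    simpleRoot n i = basisVec i - basisVec k := by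
  rw [simpleRoot, if_neg (by omega), e_succ, ← e_succ k]
  congr 2
  omega

theorem simpleRoot_zero (h : 1 < n) :
    simpleRoot n ⟨0, by omega⟩ = basisVec ⟨0, by omega⟩ + basisVec ⟨1, h⟩ := by
  rw [simpleRoot, if_pos rfl, e_one (by omega), e_two h]

theorem heightForm_simpleRoot (h : 1 < n) (i : Fin n) : heightForm (simpleRoot n i) = 1 := by
  by_cases hi : (i : ℕ) = 0
  · have hi' : i = ⟨0, by omega⟩ := Fin.ext hi
    rw [hi', simpleRoot_zero h, heightForm_add, heightForm_basisVec, heightForm_basisVec]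
    simp
  · rw [simpleRoot_of_pos (k := ⟨i - 1, by omega⟩) (by simp; omega), heightForm_sub,
      heightForm_basisVec, heightForm_basisVec]
    simp only
    omega

/-- The height is read off by a linear form, so linear independence of the simple roots is not
needed. Rank one is excluded because there `e n 2` vanishes and the simple root of index `0` has
form value `0`. -/
theorem heightForm_sum (h : 1 < n) (c : Fin n → ℤ) :
    heightForm (∑ i, c i • simpleRoot n i) = ∑ i, c i := by
  have h1 : heightForm (∑ i, c i • simpleRoot n i) = ∑ i, c i * heightForm (simpleRoot n i) := by
    simp only [heightForm, Finset.sum_apply, Pi.smul_apply, smul_eq_mul, Finset.mul_sum]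
    rw [Finset.sum_comm]
    exact Finset.sum_congr rfl fun i _ => Finset.sum_congr rfl fun j _ => by ring
  rw [h1]
  simp [heightForm_simpleRoot h]

/-- The nonnegative combinations of the simple roots. -/
def simpleCone (n : ℕ) : Set (Fin n → ℤ) :=
  {α | ∃ c : Fin n → ℤ, (∀ i, 0 ≤ c i) ∧ α = ∑ i, c i • simpleRoot n i}

theorem zero_mem_simpleCone : (0 : Fin n → ℤ) ∈ simpleCone n :=
  ⟨0, fun _ => le_rfl, by simp⟩

theorem add_mem_simpleCone {α β : Fin n → ℤ} (hα : α ∈ simpleCone n) (hβ : β ∈ simpleCone n) :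
    α + β ∈ simpleCone n := by
  obtain ⟨c, hc, rfl⟩ := hα
  obtain ⟨d, hd, rfl⟩ := hβ
  exact ⟨c + d, fun i => add_nonneg (hc i) (hd i), by simp [add_smul, Finset.sum_add_distrib]⟩

theorem simpleRoot_mem_simpleCone (i : Fin n) : simpleRoot n i ∈ simpleCone n :=
  ⟨Pi.single i 1, fun j => by rw [Pi.single_apply]; split_ifs <;> simp, by
    simp [Pi.single_apply]⟩

theorem basisVec_sub_mem_simpleCone {a b : Fin n} (h : a ≤ b) :
    basisVec b - basisVec a ∈ simpleCone n := by
  obtain ⟨b, hb⟩ := b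
  obtain ⟨d, rfl⟩ := Nat.exists_eq_add_of_le (show (a : ℕ) ≤ b from h)
  clear h
  induction d with
  | zero => simpa using zero_mem_simpleCone
  | succ d ih =>
    have h1 := add_mem_simpleCone (ih (by omega)) (simpleRoot_mem_simpleCone ⟨a + (d + 1), hb⟩)
    rw [simpleRoot_of_pos (k := ⟨a + d, by omega⟩) (by simp; omega)] at h1
    simpa using h1

theorem basisVec_add_mem_simpleCone {a b : Fin n} (h : a < b) :
    basisVec b + basisVec a ∈ simpleCone n := by
  have hab : (a : ℕ) < b := h
  have hb := b.2
  have h1 : (⟨1, by omega⟩ : Fin n) ≤ b := Fin.le_def.2 (by simp only; omega)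
  have h0 : (⟨0, by omega⟩ : Fin n) ≤ a := Fin.le_def.2 (by simp only; omega)
  have := add_mem_simpleCone (add_mem_simpleCone (basisVec_sub_mem_simpleCone h1)
    (basisVec_sub_mem_simpleCone h0)) (simpleRoot_mem_simpleCone ⟨0, by omega⟩)
  rw [simpleRoot_zero (by omega)] at this
  convert this using 1
  abel

/-- Explicit combinations of simple roots show that the listed roots are positive; the opposite
roots are excluded because `heightForm` is negative on them. -/
theorem mem_posRoots {α : Fin n → ℤ} : α ∈ posRoots n ↔
    ∃ a b : Fin n, a < b ∧ (α = basisVec b - basisVec a ∨ α = basisVec b + basisVec a) := by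
  have hidx : ∀ a b : Fin n, a < b → 1 ≤ (a : ℕ) + 1 ∧ (a : ℕ) + 1 < b + 1 ∧ (b : ℕ) + 1 ≤ n := by
    intro a b h
    have : (a : ℕ) < b := h
    omega
  have hcast : ∀ k : Fin n, e n ((k + 1 : ℕ) : ℤ) = basisVec k := fun k => by
    rw [← e_succ]; push_cast; rfl
  constructor
  · rintro ⟨⟨i, j, hi, hij, hj, h⟩, c, hc, hα⟩
    obtain ⟨a, ha⟩ : ∃ a : Fin n, (a : ℕ) + 1 = i := ⟨⟨i - 1, by omega⟩, by simp; omega⟩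
    obtain ⟨b, hb⟩ : ∃ b : Fin n, (b : ℕ) + 1 = j := ⟨⟨j - 1, by omega⟩, by simp; omega⟩
    have hab : a < b := Fin.lt_def.2 (by omega)
    have hab' : (a : ℤ) < (b : ℤ) := by omega
    rw [← ha, ← hb, hcast, hcast] at h
    have hht : 0 ≤ heightForm α := by
      rw [hα, heightForm_sum (by omega)]
      exact Finset.sum_nonneg fun i _ => hc i
    refine ⟨a, b, hab, ?_⟩
    rcases h with rfl | rfl | rfl | rfl
    · exact Or.inr (add_comm _ _)
    · rw [heightForm_neg, heightForm_add, heightForm_basisVec, heightForm_basisVec] at hht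
      omega
    · rw [heightForm_sub, heightForm_basisVec, heightForm_basisVec] at hht
      omega
    · exact Or.inl (neg_sub _ _)
  · rintro ⟨a, b, hab, rfl | rfl⟩
    · obtain ⟨h1, h2, h3⟩ := hidx a b hab
      refine ⟨⟨a + 1, b + 1, h1, h2, h3, ?_⟩, basisVec_sub_mem_simpleCone hab.le⟩
      rw [hcast, hcast, neg_sub]
      tauto
    · obtain ⟨h1, h2, h3⟩ := hidx a b hab
      refine ⟨⟨a + 1, b + 1, h1, h2, h3, ?_⟩, basisVec_add_mem_simpleCone hab⟩
      rw [hcast, hcast]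
      exact Or.inl (add_comm _ _)

theorem heightForm_pos {α : Fin n → ℤ} (h : α ∈ posRoots n) : 0 < heightForm α := by
  obtain ⟨a, b, hab, rfl | rfl⟩ := mem_posRoots.1 h
  · have : (a : ℕ) < b := hab
    rw [heightForm_sub, heightForm_basisVec, heightForm_basisVec]
    omega
  · have : (a : ℕ) < b := hab
    rw [heightForm_add, heightForm_basisVec, heightForm_basisVec]
    omega

theorem exists_odd_height_iff {α : Fin n → ℤ} (hα : α ∈ posRoots n) :
    (∃ h, HasHeight n α h ∧ Odd h) ↔ Odd (heightForm α) := by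
  have hn : 1 < n := by
    obtain ⟨a, b, hab, -⟩ := mem_posRoots.1 hα
    have : (a : ℕ) < b := hab
    omega
  constructor
  · rintro ⟨h, ⟨c, rfl, rfl⟩, hodd⟩
    rwa [heightForm_sum hn]
  · intro h
    obtain ⟨-, c, -, hc⟩ := hα
    refine ⟨heightForm α, ⟨c, hc, ?_⟩, h⟩
    rw [hc, heightForm_sum hn]

theorem basisVec_add_mem_posRoots {k l : Fin n} (h : k ≠ l) :
    basisVec k + basisVec l ∈ posRoots n := by
  rcases lt_or_gt_of_ne h with h | h
  · exact mem_posRoots.2 ⟨k, l, h, Or.inr (add_comm _ _)⟩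
  · exact mem_posRoots.2 ⟨l, k, h, Or.inr rfl⟩

theorem exists_index (z : PM n) :
    ∃ k : Fin n, (z : ℤ) = k + 1 ∨ (z : ℤ) = -((k : ℤ) + 1) := by
  have h := z.2
  simp only [Finset.mem_erase, Finset.mem_Icc] at h
  rcases lt_or_gt_of_ne h.1 with h0 | h0
  · exact ⟨⟨(-(z : ℤ) - 1).toNat, by omega⟩, Or.inr (by simp; omega)⟩
  · exact ⟨⟨((z : ℤ) - 1).toNat, by omega⟩, Or.inl (by simp; omega)⟩

theorem e_sub_mem_posRoots_of_lt {y z : PM n} (h : (y : ℤ) < z) (hyz : (y : ℤ) ≠ -z) :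
    e n z - e n y ∈ posRoots n := by
  obtain ⟨k, hk | hk⟩ := exists_index z <;> obtain ⟨l, hl | hl⟩ := exists_index y <;>
    rw [hk, hl] at h hyz ⊢
  · rw [e_succ, e_succ]
    exact mem_posRoots.2 ⟨l, k, Fin.lt_def.2 (by omega), Or.inl rfl⟩
  · rw [e_neg, e_succ, e_succ, sub_neg_eq_add]
    exact basisVec_add_mem_posRoots fun h => by rw [h] at hyz; omega
  · omega
  · rw [e_neg, e_neg, e_succ, e_succ, neg_sub_neg]
    exact mem_posRoots.2 ⟨k, l, Fin.lt_def.2 (by omega), Or.inl rfl⟩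

/-- For `z < y` the opposite difference is a positive root, and a vector and its negative cannot
both have positive height. -/
theorem e_sub_mem_posRoots {y z : PM n} (h : (y : ℤ) ≠ z) (hyz : (y : ℤ) ≠ -z) :
    e n z - e n y ∈ posRoots n ↔ (y : ℤ) < z := by
  refine ⟨fun hpos => ?_, fun hlt => e_sub_mem_posRoots_of_lt hlt hyz⟩
  by_contra hlt
  have h1 := heightForm_pos hpos
  have h2 := heightForm_pos (e_sub_mem_posRoots_of_lt (y := z) (z := y) (by omega) (by omega))
  rw [heightForm_sub] at h1 h2
  omega

end Roots

/-! ### Lengths in terms of one-line notation -/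

section Length

variable {n : ℕ}

/-- The one-line notation of a permutation of `[n]_±`. -/
def word (w : Equiv.Perm (PM n)) (k : Fin n) : ℤ := (w (PM.pos k) : PM n)

theorem word_ne {w : Equiv.Perm (PM n)} {a b : Fin n} (h : a ≠ b) : word w a ≠ word w b := by
  intro h'
  have h1 := w.injective (Subtype.ext h')
  have h2 := congrArg (fun z : PM n => (z : ℤ)) h1
  simp only [PM.pos] at h2
  exact h (Fin.ext (by omega))

theorem word_ne_neg {w : Equiv.Perm (PM n)} (hw : IsSigned w) (a b : Fin n) :
    word w a ≠ -word w b := by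
  intro h
  have h1 : w (PM.pos a) = w (PM.pos b).neg := by
    rw [hw]
    exact Subtype.ext h
  have h2 := congrArg (fun z : PM n => (z : ℤ)) (w.injective h1)
  simp only [PM.pos, PM.neg] at h2
  omega

theorem act_basisVec (w : Equiv.Perm (PM n)) (k : Fin n) :
    act w (basisVec k) = e n (word w k) := by
  simp [act, basisVec_apply, word]

theorem act_add (w : Equiv.Perm (PM n)) (u v : Fin n → ℤ) : act w (u + v) = act w u + act w v := by
  simp [act, add_smul, Finset.sum_add_distrib]

theorem act_sub (w : Equiv.Perm (PM n)) (u v : Fin n → ℤ) : act w (u - v) = act w u - act w v := by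
  simp [act, sub_smul, Finset.sum_sub_distrib]

theorem act_basisVec_sub_mem_negRoots {w : Equiv.Perm (PM n)} (hw : IsSigned w) {a b : Fin n}
    (h : a < b) : act w (basisVec b - basisVec a) ∈ negRoots n ↔ word w b < word w a := by
  rw [act_sub, act_basisVec, act_basisVec, negRoots, Set.mem_ofPred_eq, neg_sub]
  exact e_sub_mem_posRoots (word_ne h.ne') (word_ne_neg hw b a)

theorem act_basisVec_add_mem_negRoots {w : Equiv.Perm (PM n)} (hw : IsSigned w) {a b : Fin n}
    (h : a < b) :
    act w (basisVec b + basisVec a) ∈ negRoots n ↔ word w a + word w b < 0 := by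
  have h1 : -(e n (word w b) + e n (word w a)) =
      e n ((w (PM.pos b)).neg : PM n) - e n ((w (PM.pos a) : PM n) : ℤ) := by
    rw [PM.neg, e_neg, neg_add, sub_eq_add_neg]
    rfl
  rw [act_add, act_basisVec, act_basisVec, negRoots, Set.mem_ofPred_eq, h1, e_sub_mem_posRoots]
  · change word w a < -word w b ↔ _
    constructor <;> intro h <;> omega
  · exact word_ne_neg hw a b
  · change word w a ≠ - -word w b
    rw [neg_neg]
    exact word_ne h.ne

open Classical in
theorem pairCount_eq_card {α : Type*} (Q : ℕ → Prop) (R : α → α → Prop) (f : Fin n → α) :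
    pairCount Q R f = (Finset.univ.filter fun p : Fin n × Fin n =>
      p.1 < p.2 ∧ Q (p.1 + p.2) ∧ R (f p.1) (f p.2)).card := by
  rw [pairCount, Finset.sum_comm, Finset.card_filter, Fintype.sum_prod_type]

/-- The coordinates of a root determine its two positions and the sign at the smaller one, so
counting roots is counting pairs of positions, separately for the two kinds. -/
theorem ncard_roots_eq (A B : Fin n × Fin n → Prop) [DecidablePred A] [DecidablePred B] :
    {α : Fin n → ℤ | ∃ a b : Fin n, a < b ∧
      (α = basisVec b - basisVec a ∧ A (a, b) ∨ α = basisVec b + basisVec a ∧ B (a, b))}.ncard =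
      (Finset.univ.filter fun p : Fin n × Fin n => p.1 < p.2 ∧ A p).card +
      (Finset.univ.filter fun p : Fin n × Fin n => p.1 < p.2 ∧ B p).card := by
  classical
  have hsub : Set.InjOn (fun p : Fin n × Fin n => basisVec p.2 - basisVec p.1)
      (Finset.univ.filter fun p : Fin n × Fin n => p.1 < p.2 ∧ A p) := by
    rintro ⟨a, b⟩ h ⟨a', b'⟩ h' heq
    simp only [Finset.coe_filter, Finset.mem_univ, true_and, Set.mem_ofPred_eq] at h h'
    have hb := congrFun heq b
    have ha := congrFun heq a
    simp only [Pi.sub_apply, basisVec_apply, if_neg h.1.ne, if_neg h.1.ne', if_true] at ha hb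
    have h1 : b = b' := by
      by_contra hne
      rw [if_neg hne] at hb
      split_ifs at hb <;> omega
    have h2 : a = a' := by
      by_contra hne
      rw [if_neg hne] at ha
      split_ifs at ha <;> omega
    rw [h1, h2]
  have hadd : Set.InjOn (fun p : Fin n × Fin n => basisVec p.2 + basisVec p.1)
      (Finset.univ.filter fun p : Fin n × Fin n => p.1 < p.2 ∧ B p) := by
    rintro ⟨a, b⟩ h ⟨a', b'⟩ h' heq
    simp only [Finset.coe_filter, Finset.mem_univ, true_and, Set.mem_ofPred_eq] at h h'
    have hb := congrFun heq b
    have ha := congrFun heq a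
    simp only [Pi.add_apply, basisVec_apply, if_neg h.1.ne, if_neg h.1.ne', if_true] at ha hb
    have hlt : (a : ℕ) < b := h.1
    have hlt' : (a' : ℕ) < b' := h'.1
    simp only [Fin.ext_iff] at ha hb
    have h1 : b = b' := by
      refine Fin.ext ?_
      split_ifs at ha hb <;> omega
    have h2 : a = a' := by
      refine Fin.ext ?_
      split_ifs at ha hb <;> omega
    rw [h1, h2]
  rw [← Finset.card_image_of_injOn hsub, ← Finset.card_image_of_injOn hadd,
    ← Finset.card_union_of_disjoint, ← Set.ncard_coe_finset]
  · congr 1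
    ext α
    simp only [Set.mem_ofPred_eq, Finset.coe_union, Finset.coe_image, Finset.coe_filter,
      Finset.mem_univ, true_and, Set.mem_union, Set.mem_image, Prod.exists]
    constructor
    · rintro ⟨a, b, hab, ⟨rfl, hA⟩ | ⟨rfl, hB⟩⟩
      · exact Or.inl ⟨a, b, ⟨hab, hA⟩, rfl⟩
      · exact Or.inr ⟨a, b, ⟨hab, hB⟩, rfl⟩
    · rintro (⟨a, b, ⟨hab, hA⟩, rfl⟩ | ⟨a, b, ⟨hab, hB⟩, rfl⟩)
      · exact ⟨a, b, hab, Or.inl ⟨rfl, hA⟩⟩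
      · exact ⟨a, b, hab, Or.inr ⟨rfl, hB⟩⟩
  · rw [Finset.disjoint_left]
    intro α h1 h2
    obtain ⟨⟨a, b⟩, hab, rfl⟩ := Finset.mem_image.1 h1
    obtain ⟨⟨a', b'⟩, hab', heq⟩ := Finset.mem_image.1 h2
    have hlt := (Finset.mem_filter.1 hab).2.1
    have ha := congrFun heq a
    simp only [Pi.add_apply, Pi.sub_apply, basisVec_apply, if_neg hlt.ne, if_true] at ha
    split_ifs at ha <;> omega

theorem len_eq {w : Equiv.Perm (PM n)} (hw : IsSigned w) :
    len w = inv (word w) + negPairs (fun _ => True) (word w) := by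
  classical
  rw [inv, negPairs, pairCount_eq_card, pairCount_eq_card]
  simp only [true_and]
  rw [← ncard_roots_eq (fun p => word w p.2 < word w p.1)
    (fun p => word w p.1 + word w p.2 < 0), len]
  congr 1
  ext α
  simp only [Set.mem_ofPred_eq, mem_posRoots]
  constructor
  · rintro ⟨⟨a, b, hab, rfl | rfl⟩, h⟩
    · exact ⟨a, b, hab, Or.inl ⟨rfl, (act_basisVec_sub_mem_negRoots hw hab).1 h⟩⟩
    · exact ⟨a, b, hab, Or.inr ⟨rfl, (act_basisVec_add_mem_negRoots hw hab).1 h⟩⟩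
  · rintro ⟨a, b, hab, ⟨rfl, h⟩ | ⟨rfl, h⟩⟩
    · exact ⟨⟨a, b, hab, Or.inl rfl⟩, (act_basisVec_sub_mem_negRoots hw hab).2 h⟩
    · exact ⟨⟨a, b, hab, Or.inr rfl⟩, (act_basisVec_add_mem_negRoots hw hab).2 h⟩

theorem odd_heightForm_sub (a b : Fin n) :
    Odd (heightForm (basisVec b - basisVec a)) ↔ Odd ((a : ℕ) + b) := by
  rw [heightForm_sub, heightForm_basisVec, heightForm_basisVec, Int.odd_iff, Nat.odd_iff]
  omega

theorem odd_heightForm_add (a b : Fin n) :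
    Odd (heightForm (basisVec b + basisVec a)) ↔ Odd ((a : ℕ) + b) := by
  rw [heightForm_add, heightForm_basisVec, heightForm_basisVec, Int.odd_iff, Nat.odd_iff]
  omega

theorem oddLen_eq {w : Equiv.Perm (PM n)} (hw : IsSigned w) :
    oddLen w = oddInv (word w) + negPairs Odd (word w) := by
  classical
  rw [oddInv, negPairs, pairCount_eq_card, pairCount_eq_card, oddLen]
  refine Eq.trans ?_ ((ncard_roots_eq (fun p => Odd ((p.1 : ℕ) + p.2) ∧ word w p.2 < word w p.1)
    (fun p => Odd ((p.1 : ℕ) + p.2) ∧ word w p.1 + word w p.2 < 0)).trans (by congr!))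
  congr 1
  ext α
  simp only [Set.mem_ofPred_eq]
  constructor
  · rintro ⟨hpos, hodd, h⟩
    rw [exists_odd_height_iff hpos] at hodd
    obtain ⟨a, b, hab, rfl | rfl⟩ := mem_posRoots.1 hpos
    · exact ⟨a, b, hab, Or.inl ⟨rfl, (odd_heightForm_sub a b).1 hodd,
        (act_basisVec_sub_mem_negRoots hw hab).1 h⟩⟩
    · exact ⟨a, b, hab, Or.inr ⟨rfl, (odd_heightForm_add a b).1 hodd,
        (act_basisVec_add_mem_negRoots hw hab).1 h⟩⟩
  · rintro ⟨a, b, hab, ⟨rfl, hodd, h⟩ | ⟨rfl, hodd, h⟩⟩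
    · have hpos := mem_posRoots.2 ⟨a, b, hab, Or.inl rfl⟩
      exact ⟨hpos, (exists_odd_height_iff hpos).2 ((odd_heightForm_sub a b).2 hodd),
        (act_basisVec_sub_mem_negRoots hw hab).2 h⟩
    · have hpos := mem_posRoots.2 ⟨a, b, hab, Or.inr rfl⟩
      exact ⟨hpos, (exists_odd_height_iff hpos).2 ((odd_heightForm_add a b).2 hodd),
        (act_basisVec_add_mem_negRoots hw hab).2 h⟩

end Length

/-! ### The parabolic quotient and the factorization -/

section Quotient

variable {n : ℕ}

theorem transp_apply {a b : ℤ} (ha : a ≠ 0 ∧ -(n : ℤ) ≤ a ∧ a ≤ n)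
    (hb : b ≠ 0 ∧ -(n : ℤ) ≤ b ∧ b ≤ n) (z : PM n) :
    ((transp n a b z : PM n) : ℤ) = if (z : ℤ) = a then b else if (z : ℤ) = b then a else z := by
  rw [transp, dif_pos (by simpa only [Finset.mem_erase, Finset.mem_Icc] using ⟨ha, hb⟩),
    Equiv.swap_apply_def]
  simp only [Subtype.ext_iff]
  split_ifs <;> rfl

theorem simpleReflection_apply {i : ℕ} (hi : 1 ≤ i) (hin : i + 1 ≤ n) (z : PM n) :
    ((simpleReflection n i z : PM n) : ℤ) =
      if (z : ℤ) = i then (i : ℤ) + 1 else if (z : ℤ) = i + 1 then (i : ℤ)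
      else if (z : ℤ) = -i then -((i : ℤ) + 1) else if (z : ℤ) = -(i + 1) then -(i : ℤ) else z := by
  rw [simpleReflection, if_neg (by omega), Equiv.Perm.mul_apply,
    transp_apply (by omega) (by omega), transp_apply (by omega) (by omega)]
  split_ifs <;> omega

theorem isSigned_mul_simpleReflection {w : Equiv.Perm (PM n)} (hw : IsSigned w) {i : ℕ}
    (hi : 1 ≤ i) (hin : i + 1 ≤ n) : IsSigned (w * simpleReflection n i) := by
  intro z
  rw [Equiv.Perm.mul_apply, Equiv.Perm.mul_apply, ← hw]
  congr 1
  refine Subtype.ext ?_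
  have h1 : ∀ y : PM n, ((y.neg : PM n) : ℤ) = -(y : ℤ) := fun _ => rfl
  rw [h1, simpleReflection_apply hi hin, simpleReflection_apply hi hin, h1]
  have hz := z.2
  simp only [Finset.mem_erase, Finset.mem_Icc] at hz
  split_ifs <;> omega

theorem word_mul_simpleReflection (w : Equiv.Perm (PM n)) {k l : Fin n}
    (hkl : (k : ℕ) + 1 = l) :
    word (w * simpleReflection n l) = word w ∘ Equiv.swap k l := by
  funext j
  rw [word, Equiv.Perm.mul_apply, Function.comp_apply, word]
  congr 2
  refine Subtype.ext ?_
  have h1 : ∀ y : Fin n, ((PM.pos y : PM n) : ℤ) = y + 1 := fun _ => rfl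
  rw [simpleReflection_apply (by omega) l.2, h1, h1, Equiv.swap_apply_def]
  simp only [Fin.ext_iff]
  split_ifs <;> omega

/-- Right multiplication by the reflection swaps two adjacent entries; pairs with negative sum are
unaffected, so only inversions decide. -/
theorem len_lt_iff {w : Equiv.Perm (PM n)} (hw : IsSigned w) {k l : Fin n}
    (hkl : (k : ℕ) + 1 = l) :
    len w < len (w * simpleReflection n l) ↔ word w k < word w l := by
  rw [len_eq hw, len_eq (isSigned_mul_simpleReflection hw (by omega) l.2),
    word_mul_simpleReflection w hkl]
  have h : negPairs (fun _ => True) (word w ∘ Equiv.swap k l) =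
      negPairs (fun _ => True) (word w) :=
    pairCount_comp_perm (fun a b => by rw [add_comm]) _ _ fun _ _ => Iff.rfl
  rw [h, add_lt_add_iff_right]
  refine inv_lt_inv_comp_swap_iff (word w) (fun a b hab => ?_) k l hkl
  by_contra hne
  exact word_ne hne hab

theorem forall_len_lt_iff {w : Equiv.Perm (PM n)} (hw : IsSigned w) {I : Finset ℕ}
    (hI : I ⊆ Finset.Icc 1 (n - 1)) : (∀ i ∈ I, len w < len (w * simpleReflection n i)) ↔
      ∀ a b : Fin n, (a : ℕ) + 1 = b → (b : ℕ) ∈ I → word w a < word w b := by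
  constructor
  · intro h a b hab hb
    exact (len_lt_iff hw hab).1 (h b hb)
  · intro h i hi
    have := Finset.mem_Icc.1 (hI hi)
    exact (len_lt_iff (k := ⟨i - 1, by omega⟩) (l := ⟨i, by omega⟩) hw (by simp; omega)).2
      (h _ _ (by simp; omega) hi)

theorem word_injective {w w' : Equiv.Perm (PM n)} (hw : IsSigned w) (hw' : IsSigned w')
    (h : word w = word w') : w = w' := by
  have hpos : ∀ k : Fin n, w (PM.pos k) = w' (PM.pos k) := fun k =>
    Subtype.ext (congrFun h k)
  refine Equiv.ext fun z => ?_
  obtain ⟨k, hk | hk⟩ := exists_index z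
  · rw [show z = PM.pos k from Subtype.ext hk, hpos]
  · rw [show z = (PM.pos k).neg from Subtype.ext hk, hw, hw', hpos]

theorem exists_word_eq (f : Fin n → ℤ) (hf : ∀ k, f k ≠ 0 ∧ -(n : ℤ) ≤ f k ∧ f k ≤ n)
    (hinj : Function.Injective f) (hneg : ∀ a b, f a ≠ -f b) :
    ∃ w : Equiv.Perm (PM n), IsSigned w ∧ word w = f := by
  have hval : ∀ k, f k ∈ (Finset.Icc (-(n : ℤ)) (n : ℤ)).erase 0 := fun k => by
    simpa only [Finset.mem_erase, Finset.mem_Icc] using hf k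
  let p : Fin n → PM n := fun k => ⟨f k, hval k⟩
  choose idx hidx using fun z : PM n => exists_index z
  let g : PM n → PM n := fun z => if 0 < (z : ℤ) then p (idx z) else (p (idx z)).neg
  have hgpos : ∀ k, g (PM.pos k) = p k := by
    intro k
    have h1 := hidx (PM.pos k)
    have h2 : ((PM.pos k : PM n) : ℤ) = k + 1 := rfl
    have h3 : idx (PM.pos k) = k := Fin.ext (by omega)
    simp only [g]
    rw [if_pos (by omega), h3]
  have hgneg : ∀ k, g (PM.pos k).neg = (p k).neg := by
    intro k
    have h1 := hidx (PM.pos k).neg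
    have h2 : (((PM.pos k).neg : PM n) : ℤ) = -((k : ℤ) + 1) := rfl
    have h3 : idx (PM.pos k).neg = k := Fin.ext (by omega)
    simp only [g]
    rw [if_neg (by omega), h3]
  have hcases : ∀ z : PM n, ∃ k, z = PM.pos k ∨ z = (PM.pos k).neg := fun z => by
    obtain ⟨k, hk | hk⟩ := exists_index z
    · exact ⟨k, Or.inl (Subtype.ext hk)⟩
    · exact ⟨k, Or.inr (Subtype.ext hk)⟩
  have hnn : ∀ z : PM n, z.neg.neg = z := fun z => Subtype.ext (neg_neg (z : ℤ))
  have hpp : ∀ {a b}, p a = p b → a = b := fun h => hinj (congrArg Subtype.val h)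
  have hpn : ∀ {a b}, p a ≠ (p b).neg := fun h => hneg _ _ (congrArg Subtype.val h)
  have hginj : Function.Injective g := by
    intro y z h
    obtain ⟨k, rfl | rfl⟩ := hcases y <;> obtain ⟨l, rfl | rfl⟩ := hcases z
    · rw [hgpos, hgpos] at h
      rw [hpp h]
    · rw [hgpos, hgneg] at h
      exact absurd h hpn
    · rw [hgpos, hgneg] at h
      exact absurd h.symm hpn
    · rw [hgneg, hgneg] at h
      have := congrArg PM.neg h
      rw [hnn, hnn] at this
      rw [hpp this]
  refine ⟨Equiv.ofBijective g (Finite.injective_iff_bijective.1 hginj), fun z => ?_, ?_⟩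
  · simp only [Equiv.ofBijective_apply]
    obtain ⟨k, rfl | rfl⟩ := hcases z
    · rw [hgneg, hgpos]
    · rw [hnn, hgpos, hgneg, hnn]
  · funext k
    rw [word, Equiv.ofBijective_apply, hgpos]

/-- Every signed permutation is an increasing signed word composed with a permutation of the
positions. -/
theorem exists_signedWord_comp {w : Equiv.Perm (PM n)} (hw : IsSigned w) :
    ∃ (ε : Fin n → Bool) (v : Equiv.Perm (Fin n)), word w = signedWord n ε ∘ v := by
  have habs : ∀ k : Fin n, ∃ l : Fin n, word w k = l + 1 ∨ word w k = -((l : ℤ) + 1) := fun k =>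
    exists_index (w (PM.pos k))
  choose l hl using habs
  have hlinj : Function.Injective l := by
    intro a b hab
    by_contra hne
    have h1 := word_ne (w := w) hne
    have h2 := word_ne_neg hw a b
    have h3 := hl a
    have h4 := hl b
    rw [hab] at h3
    omega
  -- `σ` sends a position to the index of the absolute value of its entry, so `ε k` records the sign
  -- of the entry `±(k + 1)`.
  let σ := Equiv.ofBijective l (Finite.injective_iff_bijective.1 hlinj)
  let ε : Fin n → Bool := fun k => decide (word w (σ.symm k) < 0)
  have hex : ∀ k, ∃ j, signedWord n ε j = word w k := by
    intro k
    rw [mem_range_signedWord]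
    refine ⟨l k, ?_⟩
    have h1 : σ.symm (l k) = k := σ.symm_apply_apply k
    have h2 := hl k
    simp only [ε, h1, decide_eq_true_eq]
    split_ifs <;> omega
  choose j hj using hex
  have hjinj : Function.Injective j := by
    intro a b hab
    by_contra hne
    exact word_ne (w := w) hne (by rw [← hj a, ← hj b, hab])
  exact ⟨ε, Equiv.ofBijective j (Finite.injective_iff_bijective.1 hjinj),
    funext fun k => (hj k).symm⟩

theorem signedWord_comp_injective {ε ε' : Fin n → Bool} {v v' : Equiv.Perm (Fin n)}
    (h : signedWord n ε ∘ v = signedWord n ε' ∘ v') : ε = ε' ∧ v = v' := by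
  have hε : ε = ε' := by
    funext k
    obtain ⟨j, hj⟩ := (mem_range_signedWord ε _).2 ⟨k, rfl⟩
    have h1 := congrFun h (v.symm j)
    rw [Function.comp_apply, Function.comp_apply, Equiv.apply_symm_apply, hj] at h1
    obtain ⟨l, hl⟩ := (mem_range_signedWord ε' _).1 ⟨_, h1.symm⟩
    have hkl : k = l := Fin.ext (by split_ifs at hl <;> omega)
    subst hkl
    cases h2 : ε k <;> cases h3 : ε' k <;> simp only [h2, h3] at hl <;>
      first | rfl | (simp only [if_true, Bool.false_eq_true, if_false] at hl; omega)
  subst hε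
  exact ⟨rfl, Equiv.ext fun k => (signedWord_strictMono ε).injective (congrFun h k)⟩

theorem negCount_comp (f : Fin n → ℤ) (v : Equiv.Perm (Fin n)) : negCount (f ∘ v) = negCount f := by
  rw [negCount, negCount, Finset.card_filter, Finset.card_filter]
  exact Equiv.sum_comp v fun k => if f k < 0 then 1 else 0

theorem mem_quotient {I : Finset ℕ} (hI : I ⊆ Finset.Icc 1 (n - 1)) {w : Equiv.Perm (PM n)}
    (hw : IsSigned w) {ε : Fin n → Bool} {v : Equiv.Perm (Fin n)}
    (h : word w = signedWord n ε ∘ v) :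
    w ∈ quotient n I ↔ negCount (signedWord n ε) % 2 = 0 ∧ IncreasingOn I v := by
  have h1 : (Finset.univ.filter fun k : Fin n => ((w (PM.pos k) : PM n) : ℤ) < 0).card =
      negCount (signedWord n ε) := by
    rw [← negCount_comp _ v, ← h]
    rfl
  rw [quotient, Finset.mem_filter, forall_len_lt_iff hw hI, evenHyperoctahedral,
    Finset.mem_filter, h1, Nat.even_iff, h]
  simp only [Finset.mem_univ, true_and, hw, Function.comp_apply,
    (signedWord_strictMono ε).lt_iff_lt]
  rfl

variable {K : Type*} [Field K] (x : K)

-- Pairs `(ε, v)` parametrize the signed permutations. Being in the group depends on `ε` only and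
-- the ascent condition on `v` only, so `sum_comp_strictMono` splits the sum.
open Classical in
theorem sum_quotient {I : Finset ℕ} (hI : I ⊆ Finset.Icc 1 (n - 1)) :
    ∑ w ∈ quotient n I, (-1) ^ len w * x ^ oddLen w =
      signTotal x n 0 * fullTotal x I n := by
  have hex : ∀ p : (Fin n → Bool) × Equiv.Perm (Fin n), ∃ w : Equiv.Perm (PM n),
      IsSigned w ∧ word w = signedWord n p.1 ∘ p.2 := fun p => by
    refine exists_word_eq _ (fun k => ?_)
      ((signedWord_strictMono p.1).injective.comp p.2.injective)
      fun a b h => signedWord_abs_injective _ h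
    have := signedWord_bounds p.1 (p.2 k)
    exact ⟨this.2.2, this.1, this.2.1⟩
  choose F hF hF' using hex
  have h1 : signTotal x n 0 * fullTotal x I n =
      ∑ p : (Fin n → Bool) × Equiv.Perm (Fin n),
        if negCount (signedWord n p.1) % 2 = 0 ∧ IncreasingOn I p.2 then
          (-1) ^ len (F p) * x ^ oddLen (F p) else 0 := by
    rw [Fintype.sum_prod_type, signTotal, Finset.sum_mul]
    refine Finset.sum_congr rfl fun ε _ => ?_
    by_cases hε : negCount (signedWord n ε) % 2 = 0
    · rw [if_pos hε, ← sum_comp_strictMono x (signedWord_strictMono ε) I]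
      refine Finset.sum_congr rfl fun v _ => ?_
      rw [len_eq (hF _), oddLen_eq (hF _), hF']
      simp only [hε, true_and]
    · rw [if_neg hε, zero_mul, Finset.sum_eq_zero]
      exact fun v _ => if_neg fun h => hε h.1
  rw [h1, ← Finset.sum_filter]
  symm
  refine Finset.sum_bij (fun p _ => F p) (fun p hp => ?_) (fun p _ p' _ h => ?_)
    (fun w hw => ?_) fun _ _ => rfl
  · exact (mem_quotient hI (hF p) (hF' p)).2 (Finset.mem_filter.1 hp).2
  · have h2 : signedWord n p.1 ∘ p.2 = signedWord n p'.1 ∘ p'.2 := by rw [← hF', ← hF', h]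
    obtain ⟨h3, h4⟩ := signedWord_comp_injective h2
    exact Prod.ext h3 h4
  · have hs : IsSigned w := by
      rw [quotient, Finset.mem_filter, evenHyperoctahedral, Finset.mem_filter] at hw
      exact hw.1.2.1
    obtain ⟨ε, v, h⟩ := exists_signedWord_comp hs
    exact ⟨(ε, v), Finset.mem_filter.2 ⟨Finset.mem_univ _, (mem_quotient hI hs h).1 hw⟩,
      word_injective (hF _) hs ((hF' _).trans h.symm)⟩

theorem ratFunc_one_sub_pow_ne_zero (i : ℕ) : 1 - (RatFunc.X : RatFunc ℤ) ^ (i + 1) ≠ 0 := by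
  have h : (1 - Polynomial.X ^ (i + 1) : Polynomial ℤ) ≠ 0 := by
    intro h
    -- At `2` the polynomial is negative.
    have := congrArg (Polynomial.eval 2) h
    simp only [Polynomial.eval_sub, Polynomial.eval_one, Polynomial.eval_pow, Polynomial.eval_X,
      Polynomial.eval_zero] at this
    have h2 : (1 : ℤ) < 2 ^ (i + 1) := one_lt_pow₀ (by norm_num) (by omega)
    omega
  have h3 := (map_ne_zero_iff _ (RatFunc.algebraMap_injective ℤ)).2 h
  simpa using h3

theorem ratFunc_one_add_pow_ne_zero (i : ℕ) : 1 + (RatFunc.X : RatFunc ℤ) ^ i ≠ 0 := by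
  have h : (1 + Polynomial.X ^ i : Polynomial ℤ) ≠ 0 := by
    intro h
    have := congrArg (Polynomial.eval 1) h
    simp at this
  have h3 := (map_ne_zero_iff _ (RatFunc.algebraMap_injective ℤ)).2 h
  simpa using h3

end Quotient

end OddLengthD

theorem proposition5p2 (n : ℕ) (I : Finset ℕ) (hI : I ⊆ Finset.Icc 1 (n - 1)) :
    algebraMap (Polynomial ℤ) (RatFunc ℤ) (OddLengthD.genFun n I) =
      OddLengthD.CI I *
        (∏ i ∈ Finset.Icc 2 n, (1 + (-1) ^ (i - 1) * (RatFunc.X : RatFunc ℤ) ^ (i / 2))) *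
        ∏ i ∈ Finset.Icc (2 * OddLengthD.mI I + 2) n,
          (1 + (-1) ^ (i - 1) * (RatFunc.X : RatFunc ℤ) ^ (i / 2)) := by
  have h1 : algebraMap (Polynomial ℤ) (RatFunc ℤ) (OddLengthD.genFun n I) =
      ∑ w ∈ OddLengthD.quotient n I,
        (-1) ^ OddLengthD.len w * (RatFunc.X : RatFunc ℤ) ^ OddLengthD.oddLen w := by
    simp [OddLengthD.genFun]
  rw [h1, OddLengthD.sum_quotient _ hI, OddLengthD.signTotal_zero,
    OddLengthD.fullTotal_eq OddLengthD.ratFunc_one_sub_pow_ne_zero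
      OddLengthD.ratFunc_one_add_pow_ne_zero n I hI,
    ← OddLengthD.qMultinomial_eq OddLengthD.ratFunc_one_sub_pow_ne_zero, OddLengthD.CI,
    OddLengthD.signedProd, OddLengthD.signedProd]
  ring
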